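/- Let $d\ge 0$ be an integer and let $q_{ij}\in\mathbb C$, $1\le i\ne j\le d$, satisfy $|q_{ij}|<1$ and $q_{ji}=\overline{q_{ij}}$. Let $W$ be the universal unital $C^*$-algebra generated by elements $s_1,\dots,s_d$ subject to $s_i^*s_i=1$ and $s_i^*s_j=q_{ij}s_js_i^*$ for $i\neq j$ (the Hausdorff completion of the $*$-algebra with these generators and relations in its largest $C^*$-seminorm). For a letter $j$ and a (finite or infinite) word $\beta$ in the letters $1,\dots,d$ write $\beta\setminus j$ for $\beta$ with the first occurrence of $j$ removed ($\beta\setminus j=\beta$ if $j$ does not occur), and $\sigma_j(\beta)=(j,\beta_1,\beta_2,\dots)$. Let $q(j,\beta)$ be the product of the $q_{jk}$ over the letters $k$ of $\beta$ preceding the first $j$ (over all letters if $\beta$ is finite and does not contain $j$). For finite words put $q(\emptyset,\nu)=1$ and $q((j,\mu),\nu)=q(j,\nu)\,q(\mu,\nu\setminus j)$. The Fock space $\mathcal F$ is the completion of the span of vectors $e_\mu$, $\mu$ a finite word, for the positive form $(e_\mu,e_\nu)_F=q(\nu,\mu)$ if $\nu$ is a permutation of $\mu$ and $(e_\mu,e_\nu)_F=0$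 otherwise. The Fock representation is $\pi_F(s_j)e_\mu=e_{\sigma_j(\mu)}$, and $\pi_F(s_j^*)e_\mu=q(j,\mu)e_{\mu\setminus j}$ if $\mu$ contains $j$ and $0$ otherwise. Infinite words $\beta,\gamma$ are equivalent, $\beta\sim\gamma$, if there are $m,n\ge 0$ with $\beta_{m+k}=\gamma_{n+k}$ for all $k\ge 1$. For an infinite word $\alpha$ let $H_\alpha$ be the completion of the span of vectors $e_\beta$, $\beta\sim\alpha$, for the positive form given by $(e_\beta,e_\gamma)=(e_{(\beta_1,\dots,\beta_m)},e_{(\gamma_1,\dots,\gamma_m)})_F$ if $\beta_k=\gamma_k$ for all $k>m$ (for any such $m$), and $(e_\beta,e_\gamma)=0$ if $\beta,\gamma$ differ at infinitely many places. Theorem. The Fock representation $\pi_F$ of $W$ exists and is unique; for all infinite words $\alpha$ and all $\beta,\gamma\sim\alpha$ one has $(e_\beta,e_\gamma)=\lim_{m\to\infty}q((\gamma_1,\dots,\gamma_m),(\beta_1,\dots,\beta_m))$. Moreover, for all infinite words $\alpha,\alpha'$: 1. There is exactly one $*$-representation $\pi_\alpha$ of $W$ by bounded operators on $H_\alpha$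 such that for all $j$ and $\beta\sim\alpha$ $$\pi_\alpha(s_j)e_\beta=e_{\sigma_j(\beta)},\qquad \pi_\alpha(s_j^*)e_\beta=\begin{cases}q(j,\beta)e_{\beta\setminus j},&\beta\text{ contains }j,\\0,&\text{otherwise.}\end{cases}$$ 2. $\pi_\alpha$ is irreducible. 3. $\pi_\alpha$ and $\pi_{\alpha'}$ are unitarily equivalent if and only if $\alpha\sim\alpha'$. 4. $\pi_\alpha$ is not unitarily equivalent to the Fock representation $\pi_F$. Consequently, if $d\ge 2$, there are infinitely many pairwise unitarily inequivalent representations among the $\pi_\alpha$, all of them irreducible and not equivalent to $\pi_F$. If $q_{ij}=0$ for all $i\ne j$, then the vectors $e_\beta$, $\beta\sim\alpha$, form an orthonormal basis of $H_\alpha$ and the $\pi_\alpha(s_j)$ satisfy the relations $\pi_\alpha(s_i)^*\pi_\alpha(s_j)=\delta_{ij}1$, $\sum_j\pi_\alpha(s_j)\pi_\alpha(s_j)^*=1$ of the Cuntz algebra $\mathcal O_d$. -/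

import Mathlib

noncomputable section

namespace QIsom

open scoped ComplexOrder

/-- The coefficients `q i j`, `i ≠ j`, of the relations: `q j i` is the complex conjugate of `q i j`,
and `|q i j| < 1`. The diagonal entries `q i i` play no role. -/
structure QData (d : ℕ) where
  q : Fin d → Fin d → ℂ
  conj_q : ∀ i j, i ≠ j → q j i = starRingEnd ℂ (q i j)
  norm_q_lt_one : ∀ i j, i ≠ j → ‖q i j‖ < 1

section FreeStarAlgebra

/-- The free unital complex `*`-algebra on generators `s_0, …, s_{d-1}`: finite linear combinations
of words in the letters `(i, true)`, standing for `s_i`, and `(i, false)`, standing for `s_i^*`. -/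
def FreeStarAlg (d : ℕ) : Type := MonoidAlgebra ℂ (FreeMonoid (Fin d × Bool))

variable {d : ℕ}

instance : Ring (FreeStarAlg d) := inferInstanceAs (Ring (MonoidAlgebra ℂ _))
instance : Algebra ℂ (FreeStarAlg d) := inferInstanceAs (Algebra ℂ (MonoidAlgebra ℂ _))

/-- The monomial `c • w`. -/
def FreeStarAlg.mono (w : FreeMonoid (Fin d × Bool)) (c : ℂ) : FreeStarAlg d :=
  MonoidAlgebra.single w c

lemma FreeStarAlg.mono_mul_mono (v w : FreeMonoid (Fin d × Bool)) (a b : ℂ) :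
    mono v a * mono w b = mono (v * w) (a * b) :=
  MonoidAlgebra.single_mul_single v w a b

lemma FreeStarAlg.smul_mono (w : FreeMonoid (Fin d × Bool)) (a b : ℂ) :
    a • mono w b = mono w (a * b) :=
  MonoidAlgebra.smul_single a w b

lemma FreeStarAlg.one_eq : (1 : FreeStarAlg d) = mono 1 1 := rfl

lemma FreeStarAlg.induction {motive : FreeStarAlg d → Prop} (x : FreeStarAlg d)
    (zero : motive 0) (plus : ∀ x y, motive x → motive y → motive (x + y))
    (mono : ∀ w c, motive (mono w c)) : motive x :=
  MonoidAlgebra.induction_linear x zero plus mono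

/-- The adjoint of a word: reverse the order of the letters and exchange `s_i` and `s_i^*`. -/
def adjWord (w : FreeMonoid (Fin d × Bool)) : FreeMonoid (Fin d × Bool) :=
  (FreeMonoid.map (fun x : Fin d × Bool => (x.1, !x.2)) w).reverse

lemma adjWord_mul (v w : FreeMonoid (Fin d × Bool)) :
    adjWord (v * w) = adjWord w * adjWord v := by
  simp [adjWord, FreeMonoid.reverse_mul]

lemma adjWord_adjWord (w : FreeMonoid (Fin d × Bool)) : adjWord (adjWord w) = w := by
  have key : ∀ l : List (Fin d × Bool),
      ((l.map (fun x => (x.1, !x.2))).reverse.map (fun x => (x.1, !x.2))).reverse = l := by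
    intro l
    rw [List.map_reverse, List.reverse_reverse, List.map_map]
    simp [Function.comp_def]
  exact key w

/-- The conjugate-linear extension of `adjWord`. -/
def FreeStarAlg.adj : FreeStarAlg d →+ FreeStarAlg d :=
  MonoidAlgebra.liftNC (k := ℂ) (R := FreeStarAlg d)
    ((algebraMap ℂ (FreeStarAlg d)).toAddMonoidHom.comp (starRingEnd ℂ).toAddMonoidHom)
    (fun w => mono (adjWord w) 1)

lemma FreeStarAlg.adj_mono (w : FreeMonoid (Fin d × Bool)) (c : ℂ) :
    adj (mono w c) = mono (adjWord w) (starRingEnd ℂ c) := by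
  refine (MonoidAlgebra.liftNC_single _ _ _ _).trans ?_
  change algebraMap ℂ (FreeStarAlg d) (starRingEnd ℂ c) * mono (adjWord w) 1 = _
  rw [← Algebra.smul_def, smul_mono, mul_one]

instance : StarRing (FreeStarAlg d) where
  star := FreeStarAlg.adj
  star_involutive x := by
    induction x using FreeStarAlg.induction with
    | zero => simp
    | plus x y hx hy => rw [map_add, map_add, hx, hy]
    | mono w c => simp [FreeStarAlg.adj_mono, adjWord_adjWord]
  star_add x y := map_add _ x y
  star_mul x y := by
    change FreeStarAlg.adj (x * y) = FreeStarAlg.adj y * FreeStarAlg.adj x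
    induction x using FreeStarAlg.induction with
    | zero => simp
    | plus x x' hx hx' => rw [add_mul, map_add, hx, hx', map_add, mul_add]
    | mono v a =>
      induction y using FreeStarAlg.induction with
      | zero => simp
      | plus y y' hy hy' => rw [mul_add, map_add, hy, hy', map_add, add_mul]
      | mono w b =>
        simp only [FreeStarAlg.adj_mono, FreeStarAlg.mono_mul_mono, adjWord_mul, map_mul]
        rw [mul_comm]

lemma FreeStarAlg.star_mono (w : FreeMonoid (Fin d × Bool)) (c : ℂ) :
    star (mono w c) = mono (adjWord w) (starRingEnd ℂ c) := adj_mono w c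

instance : StarModule ℂ (FreeStarAlg d) where
  star_smul r x := by
    induction x using FreeStarAlg.induction with
    | zero => simp
    | plus x y hx hy => rw [smul_add, star_add, hx, hy, star_add, smul_add]
    | mono w c =>
      simp [FreeStarAlg.smul_mono, FreeStarAlg.star_mono]

/-- The generator `s_j`. -/
def FreeStarAlg.gen (j : Fin d) : FreeStarAlg d := mono (FreeMonoid.of (j, true)) 1

lemma FreeStarAlg.star_gen (j : Fin d) :
    star (gen j) = mono (FreeMonoid.of (j, false)) 1 := by
  rw [gen, star_mono, map_one]; rfl

end FreeStarAlgebra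

section UniversalAlgebra

variable {d : ℕ} (P : QData d)

/-- The `C^*`-seminorms on the `*`-algebra with generators `s_j` and relations
`s_i^* s_i = 1`, `s_i^* s_j = q_ij s_j s_i^*` (`i ≠ j`), seen as seminorms on the free `*`-algebra. -/
structure IsCStarSeminorm (p : Seminorm ℂ (FreeStarAlg d)) : Prop where
  map_mul_le : ∀ x y, p (x * y) ≤ p x * p y
  map_star_mul_self : ∀ x, p (star x * x) = p x * p x
  isometry : ∀ i, p (star (FreeStarAlg.gen i) * FreeStarAlg.gen i - 1) = 0
  commutation : ∀ i j, i ≠ j →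
    p (star (FreeStarAlg.gen i) * FreeStarAlg.gen j
      - P.q i j • (FreeStarAlg.gen j * star (FreeStarAlg.gen i))) = 0

lemma IsCStarSeminorm.map_star {P : QData d} {p : Seminorm ℂ (FreeStarAlg d)}
    (hp : IsCStarSeminorm P p) (x : FreeStarAlg d) : p (star x) = p x := by
  have key : ∀ y, p y ≤ p (star y) := by
    intro y
    by_contra! h
    have h1 := hp.map_star_mul_self y
    have h2 := hp.map_mul_le (star y) y
    have h3 : 0 ≤ p (star y) := apply_nonneg p _
    nlinarith
  refine le_antisymm ?_ (key x)
  simpa using key (star x)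

lemma IsCStarSeminorm.map_one_le {P : QData d} {p : Seminorm ℂ (FreeStarAlg d)}
    (hp : IsCStarSeminorm P p) : p 1 ≤ 1 := by
  have h := hp.map_star_mul_self 1
  rw [star_one, one_mul] at h
  by_contra! h1
  nlinarith

lemma IsCStarSeminorm.map_gen_le {P : QData d} {p : Seminorm ℂ (FreeStarAlg d)}
    (hp : IsCStarSeminorm P p) (i : Fin d) : p (FreeStarAlg.gen i) ≤ 1 := by
  have h := hp.map_star_mul_self (FreeStarAlg.gen i)
  have h1 : p (star (FreeStarAlg.gen i) * FreeStarAlg.gen i) ≤ 1 := by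
    have h2 := map_add_le_add p (star (FreeStarAlg.gen i) * FreeStarAlg.gen i - 1) 1
    rw [sub_add_cancel, hp.isometry, zero_add] at h2
    exact h2.trans hp.map_one_le
  by_contra! h3
  nlinarith

lemma IsCStarSeminorm.map_mono_le {P : QData d} {p : Seminorm ℂ (FreeStarAlg d)}
    (hp : IsCStarSeminorm P p) (w : FreeMonoid (Fin d × Bool)) (c : ℂ) :
    p (FreeStarAlg.mono w c) ≤ ‖c‖ := by
  have key : p (FreeStarAlg.mono w 1) ≤ 1 := by
    induction w using FreeMonoid.inductionOn' with
    | one => exact hp.map_one_le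
    | of_mul x w ih =>
      have h1 : FreeStarAlg.mono (FreeMonoid.of x * w) 1
          = FreeStarAlg.mono (FreeMonoid.of x) 1 * FreeStarAlg.mono w 1 := by
        rw [FreeStarAlg.mono_mul_mono, one_mul]
      have h2 : p (FreeStarAlg.mono (FreeMonoid.of x) 1) ≤ 1 := by
        obtain ⟨i, b⟩ := x
        cases b with
        | true => exact hp.map_gen_le i
        | false => rw [← FreeStarAlg.star_gen, hp.map_star]; exact hp.map_gen_le i
      rw [h1]
      refine (hp.map_mul_le _ _).trans ?_
      exact mul_le_one₀ h2 (apply_nonneg p _) ih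
  have h : FreeStarAlg.mono w c = c • FreeStarAlg.mono w 1 := by
    rw [FreeStarAlg.smul_mono, mul_one]
  rw [h, map_smul_eq_mul]
  exact mul_le_of_le_one_right (norm_nonneg c) key

lemma isCStarSeminorm_zero : IsCStarSeminorm P 0 where
  map_mul_le _ _ := by simp
  map_star_mul_self _ := by simp
  isometry _ := by simp
  commutation _ _ _ := by simp

instance : Nonempty {p : Seminorm ℂ (FreeStarAlg d) // IsCStarSeminorm P p} :=
  ⟨⟨0, isCStarSeminorm_zero P⟩⟩

lemma bddAbove_seminorms (x : FreeStarAlg d) : BddAbove (Set.range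
    fun p : {p : Seminorm ℂ (FreeStarAlg d) // IsCStarSeminorm P p} => p.1 x) := by
  suffices h : ∃ C, ∀ p : Seminorm ℂ (FreeStarAlg d), IsCStarSeminorm P p → p x ≤ C by
    obtain ⟨C, hC⟩ := h
    refine ⟨C, ?_⟩
    rintro _ ⟨p, rfl⟩
    exact hC p.1 p.2
  induction x using FreeStarAlg.induction with
  | zero => exact ⟨0, fun p _ => by simp⟩
  | plus x y hx hy =>
    obtain ⟨C, hC⟩ := hx
    obtain ⟨D, hD⟩ := hy
    exact ⟨C + D, fun p hp => (map_add_le_add p x y).trans (by linarith [hC p hp, hD p hp])⟩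
  | mono w c => exact ⟨‖c‖, fun p hp => hp.map_mono_le w c⟩

/-- The largest `C^*`-seminorm on the `*`-algebra defined by the relations. -/
def univNorm (x : FreeStarAlg d) : ℝ :=
  ⨆ p : {p : Seminorm ℂ (FreeStarAlg d) // IsCStarSeminorm P p}, p.1 x

variable {P} in
lemma IsCStarSeminorm.le_univNorm {p : Seminorm ℂ (FreeStarAlg d)}
    (hp : IsCStarSeminorm P p) (x : FreeStarAlg d) : p x ≤ univNorm P x :=
  le_ciSup (bddAbove_seminorms P x) ⟨p, hp⟩

lemma univNorm_nonneg (x : FreeStarAlg d) : 0 ≤ univNorm P x :=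
  Real.iSup_nonneg fun p => apply_nonneg p.1 x

lemma univNorm_le {x : FreeStarAlg d} {C : ℝ}
    (h : ∀ p : Seminorm ℂ (FreeStarAlg d), IsCStarSeminorm P p → p x ≤ C) : univNorm P x ≤ C :=
  ciSup_le fun p => h p.1 p.2

/-- The largest `C^*`-seminorm, as a seminorm. -/
def univSeminorm : Seminorm ℂ (FreeStarAlg d) :=
  Seminorm.of (univNorm P)
    (fun x y => univNorm_le P fun p hp => (map_add_le_add p x y).trans
      (add_le_add (hp.le_univNorm x) (hp.le_univNorm y)))
    (fun c x => by
      rw [univNorm, univNorm, Real.mul_iSup_of_nonneg (norm_nonneg c)]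
      exact iSup_congr fun p => map_smul_eq_mul p.1 c x)

lemma isCStarSeminorm_univSeminorm : IsCStarSeminorm P (univSeminorm P) where
  map_mul_le x y := univNorm_le P fun p hp => (hp.map_mul_le x y).trans
    (mul_le_mul (hp.le_univNorm x) (hp.le_univNorm y) (apply_nonneg p y) (univNorm_nonneg P x))
  map_star_mul_self x := by
    change univNorm P (star x * x) = univNorm P x * univNorm P x
    refine le_antisymm (univNorm_le P fun p hp => ?_) ?_
    · rw [hp.map_star_mul_self]
      exact mul_self_le_mul_self (apply_nonneg p x) (hp.le_univNorm x)
    · have h : univNorm P x ≤ √(univNorm P (star x * x)) := univNorm_le P fun p hp => by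
        apply Real.le_sqrt_of_sq_le
        rw [sq, ← hp.map_star_mul_self]
        exact hp.le_univNorm _
      have h2 := mul_self_le_mul_self (univNorm_nonneg P x) h
      rwa [Real.mul_self_sqrt (univNorm_nonneg P _)] at h2
  isometry i := le_antisymm (univNorm_le P fun p hp => (hp.isometry i).le) (univNorm_nonneg P _)
  commutation i j hij :=
    le_antisymm (univNorm_le P fun p hp => (hp.commutation i j hij).le) (univNorm_nonneg P _)

lemma univNorm_neg_add_self (x : FreeStarAlg d) : univNorm P (-x + x) = 0 := by
  rw [neg_add_cancel]; exact map_zero (univSeminorm P)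

lemma univNorm_neg_add_comm (x y : FreeStarAlg d) :
    univNorm P (-x + y) = univNorm P (-y + x) := by
  have h := map_neg_eq_map (univSeminorm P) (-x + y)
  rw [neg_add_rev, neg_neg] at h
  exact h.symm

lemma univNorm_neg_add_triangle (x y z : FreeStarAlg d) :
    univNorm P (-x + z) ≤ univNorm P (-x + y) + univNorm P (-y + z) := by
  have h := map_add_le_add (univSeminorm P) (-x + y) (-y + z)
  rwa [add_assoc, add_neg_cancel_left] at h

/-- The free `*`-algebra, endowed with the largest `C^*`-seminorm compatible with the relations. -/
def PreW (_ : QData d) : Type := FreeStarAlg d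

instance : Ring (PreW P) := inferInstanceAs (Ring (FreeStarAlg d))
instance : Algebra ℂ (PreW P) := inferInstanceAs (Algebra ℂ (FreeStarAlg d))
instance : StarRing (PreW P) := inferInstanceAs (StarRing (FreeStarAlg d))
instance : StarModule ℂ (PreW P) := inferInstanceAs (StarModule ℂ (FreeStarAlg d))

instance : SeminormedRing (PreW P) :=
  { (inferInstance : Ring (PreW P)) with
    norm := univNorm P
    dist x y := univNorm P (-x + y)
    dist_self := univNorm_neg_add_self P
    dist_comm := univNorm_neg_add_comm P
    dist_triangle := univNorm_neg_add_triangle P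
    dist_eq _ _ := rfl
    norm_mul_le := (isCStarSeminorm_univSeminorm P).map_mul_le }

lemma PreW.norm_smul' (c : ℂ) (x : PreW P) : ‖c • x‖ = ‖c‖ * ‖x‖ :=
  map_smul_eq_mul (univSeminorm P) c x

instance : NormedSpace ℂ (PreW P) :=
  { (inferInstance : Module ℂ (PreW P)) with
    norm_smul_le c x := (PreW.norm_smul' P c x).le }

lemma PreW.norm_def (x : PreW P) : ‖x‖ = univNorm P x := rfl

lemma PreW.norm_star_mul_self (x : PreW P) : ‖star x * x‖ = ‖x‖ * ‖x‖ :=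
  (isCStarSeminorm_univSeminorm P).map_star_mul_self x

lemma PreW.norm_star (x : PreW P) : ‖star x‖ = ‖x‖ :=
  (isCStarSeminorm_univSeminorm P).map_star x

lemma PreW.isometry_star : Isometry (star : PreW P → PreW P) :=
  Isometry.of_dist_eq fun x y => by
    rw [dist_eq_norm, dist_eq_norm, ← star_sub, PreW.norm_star]

/-- The universal `C^*`-algebra generated by elements `s_j` with `s_j^* s_j = 1` and
`s_i^* s_j = q_ij s_j s_i^*`, `i ≠ j`: the Hausdorff completion of the `*`-algebra defined by these
relations with respect to its largest `C^*`-seminorm. -/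
def W (P : QData d) : Type := UniformSpace.Completion (PreW P)

namespace W

open UniformSpace

instance : NormedRing (W P) := inferInstanceAs (NormedRing (Completion (PreW P)))
instance : CompleteSpace (W P) := inferInstanceAs (CompleteSpace (Completion (PreW P)))
instance : NormedAlgebra ℂ (W P) :=
  { (inferInstanceAs (Algebra ℂ (Completion (PreW P))) : Algebra ℂ (W P)) with
    norm_smul_le := fun c x =>
      (inferInstance : NormedSpace ℂ (Completion (PreW P))).norm_smul_le c x }

variable {P} in
/-- The canonical map from the free `*`-algebra. -/
def of (x : PreW P) : W P := ((x : PreW P) : Completion (PreW P))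

variable {P} in
lemma induction {motive : W P → Prop} (x : W P) (closed : IsClosed {x | motive x})
    (of : ∀ x, motive (of x)) : motive x :=
  Completion.induction_on x closed of

lemma norm_of (x : PreW P) : ‖of x‖ = ‖x‖ := Completion.norm_coe x
lemma of_add (x y : PreW P) : of (x + y) = of x + of y := Completion.coe_add x y
lemma of_mul (x y : PreW P) : of (x * y) = of x * of y := Completion.coe_mul x y
lemma of_smul (c : ℂ) (x : PreW P) : of (c • x) = c • of x := Completion.coe_smul c x

instance : Star (W P) := ⟨Completion.map (star : PreW P → PreW P)⟩

lemma continuous_star' : Continuous (star : W P → W P) := Completion.continuous_map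

lemma of_star (x : PreW P) : of (star x) = star (of x) :=
  (Completion.map_coe (PreW.isometry_star P).uniformContinuous x).symm

instance : StarRing (W P) where
  star_involutive x := by
    induction x using W.induction with
    | closed =>
      exact isClosed_eq ((continuous_star' P).comp (continuous_star' P)) continuous_id
    | of x => rw [← of_star, ← of_star, star_star]
  star_add x y := by
    induction x using W.induction with
    | closed =>
      exact isClosed_eq ((continuous_star' P).comp (continuous_id.add continuous_const))
        ((continuous_star' P).add continuous_const)
    | of x =>
      induction y using W.induction with
      | closed =>
        exact isClosed_eq ((continuous_star' P).comp (continuous_const.add continuous_id))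
          (continuous_const.add (continuous_star' P))
      | of y => rw [← of_add, ← of_star, star_add, of_add, of_star, of_star]
  star_mul x y := by
    induction x using W.induction with
    | closed =>
      exact isClosed_eq ((continuous_star' P).comp (continuous_id.mul continuous_const))
        (continuous_const.mul (continuous_star' P))
    | of x =>
      induction y using W.induction with
      | closed =>
        exact isClosed_eq ((continuous_star' P).comp (continuous_const.mul continuous_id))
          ((continuous_star' P).mul continuous_const)
      | of y => rw [← of_mul, ← of_star, star_mul, of_mul, of_star, of_star]

instance : StarModule ℂ (W P) where
  star_smul c x := by
    induction x using W.induction with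
    | closed =>
      exact isClosed_eq ((continuous_star' P).comp (continuous_const_smul c))
        ((continuous_star' P).const_smul (star c))
    | of x => rw [← of_smul, ← of_star, star_smul, of_smul, of_star]

instance : CStarRing (W P) where
  norm_mul_self_le x := by
    induction x using W.induction with
    | closed =>
      exact isClosed_le (continuous_norm.mul continuous_norm)
        (continuous_norm.comp ((continuous_star' P).mul continuous_id))
    | of x => rw [← of_star, ← of_mul, norm_of, norm_of, PreW.norm_star_mul_self]

instance : CStarAlgebra (W P) where

variable {P} in
/-- The generators `s_j` of `W`. -/
def s (j : Fin d) : W P := of (FreeStarAlg.gen j : FreeStarAlg d)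

end W

end UniversalAlgebra

section PositiveMatrices

variable {X Y : Type}

lemma posSemidef_of_finite {M : Matrix X X ℂ}
    (h : ∀ S : Finset X, ∃ N : Matrix X X ℂ, N.PosSemidef ∧ ∀ x ∈ S, ∀ y ∈ S, M x y = N x y) :
    M.PosSemidef := by
  classical
  refine ⟨?_, fun x => ?_⟩
  · ext i j
    obtain ⟨N, hN, hS⟩ := h {i, j}
    rw [Matrix.conjTranspose_apply, hS j (by simp) i (by simp), hS i (by simp) j (by simp)]
    exact hN.1.apply i j
  · obtain ⟨N, hN, hS⟩ := h x.support
    have key : (x.sum fun i xi => x.sum fun j xj => star xi * M i j * xj)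
        = x.sum fun i xi => x.sum fun j xj => star xi * N i j * xj :=
      Finset.sum_congr rfl fun i hi => Finset.sum_congr rfl fun j hj => by
        change star (x i) * M i j * x j = star (x i) * N i j * x j
        rw [hS i hi j hj]
    rw [key]
    exact hN.2 x

lemma posSemidef_rankOne (v : X → ℂ) :
    (Matrix.of fun x y => star (v x) * v y).PosSemidef := by
  refine ⟨?_, fun x => ?_⟩
  · ext i j
    simp [mul_comm]
  · have key : (x.sum fun i xi => x.sum fun j xj =>
        star xi * (Matrix.of fun x y => star (v x) * v y) i j * xj)
        = star (x.sum fun i xi => v i * xi) * x.sum fun i xi => v i * xi := by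
      simp only [Finsupp.sum, Matrix.of_apply, star_sum, Finset.sum_mul, Finset.mul_sum, star_mul]
      rw [Finset.sum_comm]
      refine Finset.sum_congr rfl fun i _ => Finset.sum_congr rfl fun j _ => ?_
      ring
    rw [key]
    exact star_mul_self_nonneg _

lemma posSemidef_sum' {ι : Type} (s : Finset ι) (M : ι → Matrix X X ℂ)
    (h : ∀ i ∈ s, (M i).PosSemidef) : (∑ i ∈ s, M i).PosSemidef := by
  classical
  induction s using Finset.induction_on with
  | empty => simpa using Matrix.PosSemidef.zero
  | insert a s ha ih =>
    rw [Finset.sum_insert ha]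
    exact (h a (by simp)).add (ih fun i hi => h i (by simp [hi]))

lemma posSemidef_mul' {A B : Matrix X X ℂ} (hA : A.PosSemidef) (hB : B.PosSemidef) :
    (Matrix.of fun x y => A x y * B x y).PosSemidef :=
  Matrix.PosSemidef.hadamard (𝕜 := ℂ) hA hB

lemma posSemidef_prod' {ι : Type} (s : Finset ι) (M : ι → Matrix X X ℂ)
    (h : ∀ i ∈ s, (M i).PosSemidef) : (Matrix.of fun x y => ∏ i ∈ s, M i x y).PosSemidef := by
  classical
  induction s using Finset.induction_on with
  | empty => simpa using posSemidef_rankOne (X := X) fun _ => 1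
  | insert a s ha ih =>
    have h2 : (Matrix.of fun x y => ∏ i ∈ insert a s, M i x y)
        = Matrix.of fun x y => M a x y * ∏ i ∈ s, M i x y := by
      ext x y
      simp only [Matrix.of_apply, Finset.prod_insert ha]
    rw [h2]
    exact posSemidef_mul' (h a (by simp)) (ih fun i hi => h i (by simp [hi]))

lemma posSemidef_indicator [DecidableEq Y] (f : X → Y) :
    (Matrix.of fun x y => if f x = f y then (1 : ℂ) else 0).PosSemidef := by
  refine posSemidef_of_finite fun S => ⟨∑ c ∈ S.image f,
    Matrix.of fun x y => star (if f x = c then (1 : ℂ) else 0) * (if f y = c then (1 : ℂ) else 0),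
    posSemidef_sum' _ _ fun c _ => posSemidef_rankOne _, fun x hx y hy => ?_⟩
  rw [Matrix.sum_apply, Finset.sum_eq_single (f x)]
  · simp [eq_comm]
  · intro c _ hc
    simp [hc.symm]
  · intro h
    exact absurd (Finset.mem_image_of_mem f hx) h

/-- The Toeplitz matrix `z ^ (n - m)` for `m ≤ n`, `conj z ^ (m - n)` otherwise. -/
def toep (z : ℂ) (m n : ℕ) : ℂ := if m ≤ n then z ^ (n - m) else starRingEnd ℂ z ^ (m - n)

lemma toep_succ_succ (z : ℂ) (m n : ℕ) : toep z (m + 1) (n + 1) = toep z m n := by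
  simp [toep]

lemma toep_succ_zero (z : ℂ) (m : ℕ) : toep z (m + 1) 0 = starRingEnd ℂ z * toep z m 0 := by
  rcases m with _ | m <;> simp [toep, pow_succ']

lemma toep_zero_left (z : ℂ) (n : ℕ) : toep z 0 n = z ^ n := by simp [toep]

lemma toep_eq_sum (z : ℂ) (m n : ℕ) :
    toep z m n = starRingEnd ℂ z ^ m * z ^ n + ∑ k ∈ Finset.range (min m n),
      (1 - z * starRingEnd ℂ z) * (starRingEnd ℂ z ^ (m - 1 - k) * z ^ (n - 1 - k)) := by
  induction m generalizing n with
  | zero => simp [toep]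
  | succ m ih =>
    cases n with
    | zero => simp [toep]
    | succ n =>
      rw [toep_succ_succ, ih, Nat.succ_min_succ, Finset.sum_range_succ']
      have h : ∀ k, m + 1 - 1 - (k + 1) = m - 1 - k := by intro k; omega
      have h' : ∀ k, n + 1 - 1 - (k + 1) = n - 1 - k := by intro k; omega
      have hs : ∑ k ∈ Finset.range (min m n), (1 - z * starRingEnd ℂ z) *
            (starRingEnd ℂ z ^ (m + 1 - 1 - (k + 1)) * z ^ (n + 1 - 1 - (k + 1)))
          = ∑ k ∈ Finset.range (min m n), (1 - z * starRingEnd ℂ z) *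
            (starRingEnd ℂ z ^ (m - 1 - k) * z ^ (n - 1 - k)) :=
        Finset.sum_congr rfl fun k _ => by rw [h k, h' k]
      rw [hs]
      simp only [Nat.add_sub_cancel, Nat.sub_zero]
      ring

lemma posSemidef_toep {z : ℂ} (hz : ‖z‖ ≤ 1) : (Matrix.of (toep z)).PosSemidef := by
  obtain ⟨w, hw⟩ : ∃ w : ℂ, star w * w = 1 - z * starRingEnd ℂ z := by
    refine ⟨(√(1 - ‖z‖ ^ 2) : ℝ), ?_⟩
    have h : (0 : ℝ) ≤ 1 - ‖z‖ ^ 2 := by nlinarith [norm_nonneg z]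
    rw [Complex.mul_conj, Complex.normSq_eq_norm_sq]
    simp only [RCLike.star_def, Complex.conj_ofReal, ← Complex.ofReal_mul,
      Real.mul_self_sqrt h]
    push_cast
    rfl
  refine posSemidef_of_finite fun S => ⟨(Matrix.of fun m n => star (z ^ m) * z ^ n)
    + ∑ k ∈ Finset.range (S.sup id), Matrix.of fun m n =>
      star (if k < m then w * z ^ (m - 1 - k) else 0) * (if k < n then w * z ^ (n - 1 - k) else 0),
    (posSemidef_rankOne _).add (posSemidef_sum' _ _ fun k _ => posSemidef_rankOne _),
    fun m hm n hn => ?_⟩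
  have hm' : m ≤ S.sup id := Finset.le_sup (f := id) hm
  rw [Matrix.add_apply, Matrix.sum_apply, Matrix.of_apply, Matrix.of_apply, toep_eq_sum]
  congr 1
  · simp
  · have hsub : Finset.range (min m n) ⊆ Finset.range (S.sup id) := by
      intro k hk
      simp only [Finset.mem_range] at hk ⊢
      omega
    rw [← Finset.sum_subset hsub]
    · refine Finset.sum_congr rfl fun k hk => ?_
      have hk' := Finset.mem_range.mp hk
      rw [Matrix.of_apply, if_pos (by omega), if_pos (by omega), ← hw]
      simp only [star_mul, star_pow, RCLike.star_def]
      ring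
    · intro k _ hk
      rw [Finset.mem_range] at hk
      rw [Matrix.of_apply]
      by_cases h1 : k < m
      · rw [if_neg (show ¬ k < n by omega), mul_zero]
      · rw [if_neg h1, star_zero, zero_mul]

end PositiveMatrices
section FiniteWords

variable {d : ℕ} (P : QData d)

/-- `q(j, ν)`: the product of the `q j k` over the letters `k` of the finite word `ν` that precede
the first occurrence of `j` (over all letters of `ν` if `j` does not occur), so that
`s_j^* s_ν = q(j, ν) s_{ν ∖ j}`, respectively `s_j^* s_ν = q(j, ν) s_ν s_j^*`. -/
def QData.qLetter (j : Fin d) : List (Fin d) → ℂ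
  | [] => 1
  | k :: ν => if k = j then 1 else P.q j k * QData.qLetter j ν

/-- `q(μ, ν)`, the coefficient in `s_μ^* s_ν = q(μ, ν) s_{ν ∖ μ} s_{μ ∖ ν}^*`, computed by moving
the adjoints of the letters of `μ` through `ν` one after the other. Here `ν.erase j` is `ν ∖ j`,
the word `ν` without the first occurrence of `j` (and `ν` if `j` does not occur). -/
def QData.qWord : List (Fin d) → List (Fin d) → ℂ
  | [], _ => 1
  | j :: μ, ν => P.qLetter j ν * QData.qWord μ (ν.erase j)

/-- The Fock scalar product: the entry at `(μ, ν)` is the scalar product, linear in `e_ν` and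
conjugate-linear in `e_μ`, of the vectors `e_μ` and `e_ν`. -/
def QData.fockGram : Matrix (List (Fin d)) (List (Fin d)) ℂ :=
  Matrix.of fun μ ν => if μ.Perm ν then P.qWord μ ν else 0

/-- The letters that precede the first occurrence of `c`. -/
def pre (c : Fin d) (ν : List (Fin d)) : List (Fin d) := ν.takeWhile (· ≠ c)

lemma qLetter_eq_prod (c : Fin d) (ν : List (Fin d)) :
    P.qLetter c ν = ∏ i, P.q c i ^ (pre c ν).count i := by
  induction ν with
  | nil => simp [QData.qLetter, pre]
  | cons k ν ih =>
    by_cases h : k = c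
    · simp [QData.qLetter, pre, h]
    · have hp : pre c (k :: ν) = k :: pre c ν := by simp [pre, h]
      rw [QData.qLetter, if_neg h, ih, hp, ← Finset.mul_prod_erase _ _ (Finset.mem_univ k),
        ← Finset.mul_prod_erase _ (fun i => P.q c i ^ (k :: pre c ν).count i) (Finset.mem_univ k),
        List.count_cons_self, pow_succ', mul_assoc]
      congr 2
      refine Finset.prod_congr rfl fun i hi => ?_
      rw [List.count_cons_of_ne (Finset.ne_of_mem_erase hi).symm]

lemma erase_of_mem_pre {c j : Fin d} (hj : j ≠ c) {ν : List (Fin d)} (h : j ∈ pre c ν) :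
    pre c (ν.erase j) = (pre c ν).erase j ∧ P.qLetter j (ν.erase c) = P.qLetter j ν := by
  induction ν with
  | nil => simp [pre] at h
  | cons k ν ih =>
    by_cases hk : k = c
    · simp [pre, hk] at h
    · have hp : pre c (k :: ν) = k :: pre c ν := by simp [pre, hk]
      have ec : (k :: ν).erase c = k :: ν.erase c := List.erase_cons_tail (by simpa using hk)
      rw [ec, hp]
      by_cases hkj : k = j
      · subst hkj
        simp [QData.qLetter]
      · have hm : j ∈ pre c ν := by
          rw [hp, List.mem_cons] at h
          exact h.resolve_left (Ne.symm hkj)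
        obtain ⟨h1, h2⟩ := ih hm
        have ej : (k :: ν).erase j = k :: ν.erase j := List.erase_cons_tail (by simpa using hkj)
        have ej' : (k :: pre c ν).erase j = k :: (pre c ν).erase j :=
          List.erase_cons_tail (by simpa using hkj)
        rw [ej, ej', QData.qLetter, QData.qLetter, if_neg hkj, if_neg hkj, h2]
        refine ⟨?_, rfl⟩
        rw [← h1]
        simp [pre, hk]

lemma erase_of_notMem_pre {c j : Fin d} (hj : j ≠ c) {ν : List (Fin d)} (h : j ∉ pre c ν)
    (hc : c ∈ ν) :
    pre c (ν.erase j) = pre c ν ∧ P.qLetter j ν = P.q j c * P.qLetter j (ν.erase c) := by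
  induction ν with
  | nil => simp at hc
  | cons k ν ih =>
    by_cases hk : k = c
    · subst hk
      rw [List.erase_cons_tail (by simpa using hj.symm), List.erase_cons_head, QData.qLetter,
        if_neg hj.symm]
      simp [pre]
    · have hp : pre c (k :: ν) = k :: pre c ν := by simp [pre, hk]
      rw [hp, List.mem_cons, not_or] at h
      have hkj : ¬ k = j := fun h' => h.1 h'.symm
      obtain ⟨h1, h2⟩ := ih h.2 ((List.mem_cons.mp hc).resolve_left (Ne.symm hk))
      have ec : (k :: ν).erase c = k :: ν.erase c := List.erase_cons_tail (by simpa using hk)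
      have ej : (k :: ν).erase j = k :: ν.erase j := List.erase_cons_tail (by simpa using hkj)
      rw [ec, ej, QData.qLetter, QData.qLetter, if_neg hkj, if_neg hkj, h2, hp, ← h1]
      refine ⟨by simp [pre, hk], by ring⟩

lemma qLetter_mul_prod_toep {c j : Fin d} (hj : j ≠ c) (ν : List (Fin d)) (hc : c ∈ ν)
    (a : Fin d → ℕ) (b : Fin d → ℕ) (hb : b j = a j + 1) (hab : ∀ i, i ≠ j → b i = a i) :
    P.qLetter j ν * ∏ i, toep (P.q c i) (a i) ((pre c (ν.erase j)).count i)
      = P.qLetter j (ν.erase c) * ∏ i, toep (P.q c i) (b i) ((pre c ν).count i) := by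
  rw [← Finset.mul_prod_erase _ _ (Finset.mem_univ j),
    ← Finset.mul_prod_erase _ (fun i => toep (P.q c i) (b i) _) (Finset.mem_univ j), hb]
  by_cases h : j ∈ pre c ν
  · obtain ⟨h1, h2⟩ := erase_of_mem_pre P hj h
    obtain ⟨n, hn⟩ : ∃ n, (pre c ν).count j = n + 1 :=
      ⟨(pre c ν).count j - 1, by have := List.count_pos_iff.mpr h; omega⟩
    rw [h1, h2, List.count_erase_self, hn, toep_succ_succ, Nat.add_sub_cancel]
    congr 2
    refine Finset.prod_congr rfl fun i hi => ?_
    have hij := Finset.ne_of_mem_erase hi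
    rw [List.count_erase_of_ne hij, hab i hij]
  · obtain ⟨h1, h2⟩ := erase_of_notMem_pre P hj h hc
    rw [h1, h2, List.count_eq_zero.mpr h, toep_succ_zero, ← P.conj_q c j hj.symm]
    have h3 : ∏ i ∈ Finset.univ.erase j, toep (P.q c i) (a i) ((pre c ν).count i)
        = ∏ i ∈ Finset.univ.erase j, toep (P.q c i) (b i) ((pre c ν).count i) :=
      Finset.prod_congr rfl fun i hi => by rw [hab i (Finset.ne_of_mem_erase hi)]
    rw [h3]
    ring

lemma qWord_eq_erase (c : Fin d) (μ ν : List (Fin d)) (hμ : c ∈ μ) (hν : c ∈ ν) :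
    P.qWord μ ν = P.qWord (μ.erase c) (ν.erase c) *
      ∏ i, toep (P.q c i) ((pre c μ).count i) ((pre c ν).count i) := by
  induction μ generalizing ν with
  | nil => simp at hμ
  | cons j μ ih =>
    by_cases hj : j = c
    · subst hj
      have hp : pre j (j :: μ) = [] := by simp [pre]
      rw [QData.qWord, qLetter_eq_prod, List.erase_cons_head, hp, mul_comm]
      simp [toep_zero_left]
    · have hμ' : c ∈ μ := (List.mem_cons.mp hμ).resolve_left (Ne.symm hj)
      have hp : pre c (j :: μ) = j :: pre c μ := by simp [pre, hj]
      rw [QData.qWord, ih _ hμ' ((List.mem_erase_of_ne (Ne.symm hj)).mpr hν),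
        List.erase_cons_tail (by simpa using hj), QData.qWord, List.erase_comm c j, mul_left_comm,
        qLetter_mul_prod_toep P hj ν hν (fun i => (pre c μ).count i)
          (fun i => (pre c (j :: μ)).count i) (by simp [hp])
          (fun i hi => by simp only [hp]; rw [List.count_cons_of_ne hi.symm])]
      ring

/-- A letter of a non-empty multiset of letters. -/
def someLetter (s : Multiset (Fin d)) : Option (Fin d) :=
  open Classical in if h : ∃ a, a ∈ s then some h.choose else none

lemma posSemidef_fockGram_aux (n : ℕ) : (Matrix.of fun μ ν : List (Fin d) =>
    if μ.Perm ν ∧ μ.length ≤ n then P.qWord μ ν else 0).PosSemidef := by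
  classical
  induction n with
  | zero =>
    convert posSemidef_rankOne (X := List (Fin d)) fun μ => if μ = [] then 1 else 0 using 1
    ext μ ν
    by_cases hμ : μ = []
    · subst hμ
      by_cases hν : ν = [] <;> simp [hν, QData.qWord]
    · simp [hμ]
  | succ n ih =>
    have key : (Matrix.of fun μ ν : List (Fin d) =>
        if μ.Perm ν ∧ μ.length ≤ n + 1 then P.qWord μ ν else 0) = Matrix.of fun μ ν =>
        (Matrix.of fun μ ν : List (Fin d) =>
          if (μ : Multiset (Fin d)) = (ν : Multiset (Fin d)) then (1 : ℂ) else 0) μ ν *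
        (∑ c : Option (Fin d), Matrix.of fun μ ν : List (Fin d) =>
          (Matrix.of fun μ ν : List (Fin d) =>
            star (if someLetter (μ : Multiset (Fin d)) = c then (1 : ℂ) else 0) *
            (if someLetter (ν : Multiset (Fin d)) = c then (1 : ℂ) else 0)) μ ν *
          (c.elim (Matrix.of fun _ _ => star (1 : ℂ) * 1) fun c => Matrix.of fun μ ν =>
            ((Matrix.of fun μ ν : List (Fin d) =>
              if μ.Perm ν ∧ μ.length ≤ n then P.qWord μ ν else 0).submatrix
                (fun μ => μ.erase c) (fun μ => μ.erase c)) μ ν *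
            (Matrix.of fun μ ν => ∏ i ∈ Finset.univ.erase c,
              ((Matrix.of (toep (P.q c i))).submatrix (fun μ => (pre c μ).count i)
                (fun μ => (pre c μ).count i)) μ ν) μ ν) μ ν) μ ν := by
      ext μ ν
      simp only [Matrix.of_apply, Matrix.sum_apply, Multiset.coe_eq_coe]
      by_cases hp : μ.Perm ν
      swap
      · simp [hp]
      have hp' : (μ : Multiset (Fin d)) = (ν : Multiset (Fin d)) := Multiset.coe_eq_coe.mpr hp
      rw [Finset.sum_eq_single (someLetter (μ : Multiset (Fin d)))]
      rotate_left
      · intro c _ hc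
        simp [hc.symm]
      · simp
      rw [← hp']
      by_cases h : ∃ a, a ∈ (μ : Multiset (Fin d))
      · have hs : someLetter (μ : Multiset (Fin d)) = some h.choose := dif_pos h
        have hμ : h.choose ∈ μ := by simpa using h.choose_spec
        have hν : h.choose ∈ ν := hp.subset hμ
        rw [hs]
        generalize h.choose = c at *
        have hl : (μ.erase c).length ≤ n ↔ μ.length ≤ n + 1 := by
          have := List.length_erase_add_one hμ
          omega
        have hpr : ∏ i, toep (P.q c i) ((pre c μ).count i) ((pre c ν).count i)
            = ∏ i ∈ Finset.univ.erase c,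
              toep (P.q c i) ((pre c μ).count i) ((pre c ν).count i) := by
          have h0 : ∀ l : List (Fin d), (pre c l).count c = 0 := by
            intro l
            rw [List.count_eq_zero]
            intro hc
            have := List.mem_takeWhile_imp hc
            simp at this
          rw [← Finset.mul_prod_erase _ _ (Finset.mem_univ c), h0, h0, toep_zero_left, pow_zero,
            one_mul]
        by_cases hn : μ.length ≤ n + 1
        · simp [hp, hp.erase c, hl, hn, ← hpr, qWord_eq_erase P c μ ν hμ hν]
        · simp [hl, hn]
      · have hs : someLetter (μ : Multiset (Fin d)) = none := dif_neg h
        have hμ : μ = [] := by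
          rw [List.eq_nil_iff_forall_not_mem]
          intro a ha
          exact h ⟨a, by simpa using ha⟩
        subst hμ
        rw [hs]
        simp [hp, QData.qWord]
    rw [key]
    refine posSemidef_mul' (posSemidef_indicator _) (posSemidef_sum' _ _ fun c _ =>
      posSemidef_mul' (posSemidef_rankOne _) ?_)
    cases c with
    | none => exact posSemidef_rankOne fun _ => 1
    | some c =>
      exact posSemidef_mul' (ih.submatrix _) (posSemidef_prod' _ _ fun i hi =>
        (posSemidef_toep (P.norm_q_lt_one c i (Finset.ne_of_mem_erase hi).symm).le).submatrix _)

lemma QData.posSemidef_fockGram : P.fockGram.PosSemidef := by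
  classical
  refine posSemidef_of_finite fun S => ⟨_, posSemidef_fockGram_aux P (S.sup List.length),
    fun μ hμ ν _ => ?_⟩
  have h : μ.length ≤ S.sup List.length := Finset.le_sup (f := List.length) hμ
  simp [QData.fockGram, h]

end FiniteWords

section InfiniteWords

variable {d : ℕ}

/-- Infinite multiindices `(β 0, β 1, …)`. -/
abbrev Word (d : ℕ) : Type := ℕ → Fin d

/-- The finite word formed by the first `m` letters. -/
def Word.take (β : Word d) (m : ℕ) : List (Fin d) := (List.range m).map β

lemma Word.take_succ (β : Word d) (m : ℕ) : β.take (m + 1) = β.take m ++ [β m] := by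
  simp [Word.take, List.range_succ]

/-- `σ_j(β) = (j, β 0, β 1, …)`. -/
def Word.cons (j : Fin d) (β : Word d) : Word d
  | 0 => j
  | n + 1 => β n

/-- `β` contains the letter `j`. -/
def Word.Contains (β : Word d) (j : Fin d) : Prop := ∃ k, β k = j

open Classical in
/-- `β ∖ j`: the word `β` without the first occurrence of `j` (and `β` if `j` does not occur). -/
def Word.erase (β : Word d) (j : Fin d) : Word d :=
  fun n => if ∃ k ≤ n, β k = j then β (n + 1) else β n

/-- `q(j, β)` for an infinite word `β` that contains `j`: the product of the `q j k` over the
letters `k` of `β` that precede the first occurrence of `j`. -/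
def QData.qLetterWord (P : QData d) (j : Fin d) (β : Word d) : ℂ :=
  ∏ k ∈ Finset.range (sInf {k | β k = j}), P.q j (β k)

/-- `β ∼ γ`: the two words have the same tails up to a shift. -/
def TailEquiv (β γ : Word d) : Prop := ∃ m n, ∀ k, β (m + k) = γ (n + k)

lemma TailEquiv.cons {α β : Word d} (h : TailEquiv β α) (j : Fin d) :
    TailEquiv (Word.cons j β) α := by
  obtain ⟨m, n, h⟩ := h
  refine ⟨m + 1, n, fun k => ?_⟩
  rw [add_right_comm]
  exact h k

lemma TailEquiv.erase {α β : Word d} (h : TailEquiv β α) (j : Fin d) :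
    TailEquiv (β.erase j) α := by
  by_cases hj : ∃ k, β k = j
  · obtain ⟨l, hl⟩ := hj
    obtain ⟨m, n, h⟩ := h
    refine ⟨l + m, n + l + 1, fun k => ?_⟩
    have h1 : β.erase j (l + m + k) = β (l + m + k + 1) := if_pos ⟨l, by omega, hl⟩
    rw [h1, show l + m + k + 1 = m + (l + 1 + k) by omega, h]
    congr 1
    omega
  · have h1 : β.erase j = β := funext fun n => if_neg fun ⟨k, _, hk⟩ => hj ⟨k, hk⟩
    rwa [h1]

variable (P : QData d)

lemma qLetter_append {j : Fin d} {ν : List (Fin d)} (h : j ∈ ν) (l : List (Fin d)) :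
    P.qLetter j (ν ++ l) = P.qLetter j ν := by
  induction ν with
  | nil => simp at h
  | cons k ν ih =>
    rw [List.cons_append, QData.qLetter, QData.qLetter]
    by_cases hk : k = j
    · rw [if_pos hk, if_pos hk]
    · rw [if_neg hk, if_neg hk, ih ((List.mem_cons.mp h).resolve_left (Ne.symm hk))]

lemma qWord_append_singleton {μ ν : List (Fin d)} (h : μ.Perm ν) (a : Fin d) :
    P.qWord (μ ++ [a]) (ν ++ [a]) = P.qWord μ ν := by
  induction μ generalizing ν with
  | nil =>
    rw [List.nil_perm] at h
    subst h
    simp [QData.qWord, QData.qLetter]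
  | cons j μ ih =>
    have hj : j ∈ ν := h.subset (by simp)
    rw [List.cons_append, QData.qWord, QData.qWord, qLetter_append P hj,
      List.erase_append_left _ hj, ih]
    simpa using h.erase j

lemma fockGram_append_singleton (μ ν : List (Fin d)) (a : Fin d) :
    P.fockGram (μ ++ [a]) (ν ++ [a]) = P.fockGram μ ν := by
  simp only [QData.fockGram, Matrix.of_apply, List.perm_append_right_iff]
  by_cases h : μ.Perm ν
  · rw [if_pos h, if_pos h, qWord_append_singleton P h]
  · rw [if_neg h, if_neg h]

open Classical in
/-- The scalar product of the vectors `e_γ` and `e_β`, linear in `e_β` and conjugate-linear in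
`e_γ`, for infinite words `γ` and `β`: if the two words agree from the place `m` on, this is the
Fock scalar product of their initial segments of length `m` (for every such `m`); otherwise the
vectors are orthogonal. -/
def QData.wordGram : Matrix (Word d) (Word d) ℂ := Matrix.of fun γ β =>
  if h : ∃ m, ∀ k, m ≤ k → γ k = β k then
    P.fockGram (γ.take (Nat.find h)) (β.take (Nat.find h)) else 0

lemma fockGram_take {γ β : Word d} {m : ℕ} (h : ∀ k, m ≤ k → γ k = β k) (n : ℕ) (hn : m ≤ n) :
    P.fockGram (γ.take n) (β.take n) = P.fockGram (γ.take m) (β.take m) := by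
  induction n, hn using Nat.le_induction with
  | base => rfl
  | succ n hn ih => rw [Word.take_succ, Word.take_succ, h n hn, fockGram_append_singleton, ih]

lemma QData.wordGram_eq {γ β : Word d} {m : ℕ} (h : ∀ k, m ≤ k → γ k = β k) :
    P.wordGram γ β = P.fockGram (γ.take m) (β.take m) := by
  classical
  have hex : ∃ m, ∀ k, m ≤ k → γ k = β k := ⟨m, h⟩
  have h1 : P.wordGram γ β = P.fockGram (γ.take (Nat.find hex)) (β.take (Nat.find hex)) := by
    rw [QData.wordGram, Matrix.of_apply, dif_pos hex]
  rw [h1, fockGram_take P (Nat.find_spec hex) m (Nat.find_min' hex h)]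

/-- Words that agree up to finitely many places. -/
def eventualSetoid (d : ℕ) : Setoid (Word d) where
  r γ β := ∃ m, ∀ k, m ≤ k → γ k = β k
  iseqv :=
    { refl := fun _ => ⟨0, fun _ _ => rfl⟩
      symm := fun ⟨m, h⟩ => ⟨m, fun k hk => (h k hk).symm⟩
      trans := fun ⟨m, h⟩ ⟨n, h'⟩ => ⟨max m n, fun k hk =>
        (h k (by omega)).trans (h' k (by omega))⟩ }

lemma QData.posSemidef_wordGram : P.wordGram.PosSemidef := by
  classical
  refine posSemidef_of_finite fun S => ?_
  have hN : ∃ N, ∀ γ ∈ S, ∀ β ∈ S, (∃ m, ∀ k, m ≤ k → γ k = β k) → ∀ k, N ≤ k → γ k = β k := by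
    have hf : ∀ p : Word d × Word d, ∃ N, (∃ m, ∀ k, m ≤ k → p.1 k = p.2 k) →
        ∀ k, N ≤ k → p.1 k = p.2 k := by
      intro p
      by_cases h : ∃ m, ∀ k, m ≤ k → p.1 k = p.2 k
      · obtain ⟨m, hm⟩ := h
        exact ⟨m, fun _ => hm⟩
      · exact ⟨0, fun h' => absurd h' h⟩
    choose f hf using hf
    refine ⟨(S ×ˢ S).sup f, fun γ hγ β hβ h k hk => hf (γ, β) h k ?_⟩
    exact (Finset.le_sup (f := f) (Finset.mk_mem_product hγ hβ)).trans hk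
  obtain ⟨N, hN⟩ := hN
  refine ⟨_, posSemidef_mul' (posSemidef_indicator fun γ => Quotient.mk (eventualSetoid d) γ)
    (P.posSemidef_fockGram.submatrix fun γ : Word d => γ.take N), fun γ hγ β hβ => ?_⟩
  simp only [Matrix.of_apply, Matrix.submatrix_apply]
  by_cases h : ∃ m, ∀ k, m ≤ k → γ k = β k
  · rw [if_pos (Quotient.sound (s := eventualSetoid d) h), one_mul,
      P.wordGram_eq (hN γ hγ β hβ h)]
  · rw [if_neg fun h' => h (Quotient.exact (s := eventualSetoid d) h'), zero_mul, QData.wordGram,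
      Matrix.of_apply, dif_neg h]

end InfiniteWords

section GramSpaces

variable {X : Type} {M : Matrix X X ℂ} (hM : M.PosSemidef)

/-- Finite formal linear combinations of vectors `e_x`, `x ∈ X`, with the semi-inner product given
on the `e_x` by the positive semidefinite matrix `M`. -/
def PreGram {M : Matrix X X ℂ} (_ : M.PosSemidef) : Type := X →₀ ℂ

instance : AddCommGroup (PreGram hM) := inferInstanceAs (AddCommGroup (X →₀ ℂ))
instance : Module ℂ (PreGram hM) := inferInstanceAs (Module ℂ (X →₀ ℂ))

/-- The sesquilinear form `⟪f, g⟫ = ∑ x, ∑ y, conj (f x) * g y * M x y`. -/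
def PreGram.form (f g : X →₀ ℂ) (M : Matrix X X ℂ) : ℂ :=
  f.sum fun x a => g.sum fun y b => starRingEnd ℂ a * M x y * b

lemma PreGram.form_conj {M : Matrix X X ℂ} (hM : M.PosSemidef) (f g : X →₀ ℂ) :
    starRingEnd ℂ (PreGram.form g f M) = PreGram.form f g M := by
  unfold PreGram.form
  rw [Finsupp.sum_comm]
  simp only [Finsupp.sum, map_sum, map_mul, Complex.conj_conj]
  refine Finset.sum_congr rfl fun x _ => Finset.sum_congr rfl fun y _ => ?_
  have h : starRingEnd ℂ (M y x) = M x y := hM.1.apply x y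
  rw [h]
  ring

lemma PreGram.form_add (f g h : X →₀ ℂ) (M : Matrix X X ℂ) :
    PreGram.form (f + g) h M = PreGram.form f h M + PreGram.form g h M := by
  unfold PreGram.form
  refine Finsupp.sum_add_index' ?_ ?_
  · simp
  · intro x a b
    simp [← Finsupp.sum_add, add_mul]

lemma PreGram.form_smul (c : ℂ) (f g : X →₀ ℂ) (M : Matrix X X ℂ) :
    PreGram.form (c • f) g M = starRingEnd ℂ c * PreGram.form f g M := by
  unfold PreGram.form
  refine (Finsupp.sum_smul_index ?_).trans ?_
  · simp
  · simp [Finsupp.mul_sum, mul_assoc]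

instance PreGram.core : PreInnerProductSpace.Core ℂ (PreGram hM) where
  inner f g := PreGram.form f g M
  conj_inner_symm f g := PreGram.form_conj hM f g
  re_inner_nonneg f := (Complex.nonneg_iff.mp (hM.2 f)).1
  add_left f g h := PreGram.form_add f g h M
  smul_left f g c := PreGram.form_smul c f g M

instance : SeminormedAddCommGroup (PreGram hM) :=
  InnerProductSpace.Core.toSeminormedAddCommGroup (𝕜 := ℂ)

instance : InnerProductSpace ℂ (PreGram hM) := .ofCore _

/-- The Hilbert space generated by vectors `e_x`, `x ∈ X`, with scalar products given by `M`: the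
(Hausdorff) completion of the space of finite linear combinations. -/
abbrev GramSpace {M : Matrix X X ℂ} (hM : M.PosSemidef) : Type :=
  UniformSpace.Completion (PreGram hM)

/-- The vector `e_x` of the space of finite linear combinations. -/
def PreGram.vec (x : X) : PreGram hM := Finsupp.single x (1 : ℂ)

/-- The vector `e_x`. -/
def GramSpace.vec (x : X) : GramSpace hM := (PreGram.vec hM x : PreGram hM)

lemma GramSpace.inner_vec (x y : X) : inner ℂ (vec hM x) (vec hM y) = M x y := by
  refine (UniformSpace.Completion.inner_coe _ _).trans ?_
  change PreGram.form (Finsupp.single x 1) (Finsupp.single y 1) M = M x y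
  simp [PreGram.form]

end GramSpaces

section Representations

/-- Irreducibility of a `*`-representation: the space is not zero, and no closed subspaces except
zero and the whole space are invariant. -/
def IsIrreducible {A H : Type} [CStarAlgebra A] [NormedAddCommGroup H] [InnerProductSpace ℂ H]
    [CompleteSpace H] (π : A →⋆ₐ[ℂ] (H →L[ℂ] H)) : Prop :=
  Nontrivial H ∧ ∀ K : Submodule ℂ H, IsClosed (K : Set H) → (∀ a, ∀ x ∈ K, π a x ∈ K) →
    K = ⊥ ∨ K = ⊤

/-- Unitary equivalence of `*`-representations. -/
def UnitarilyEquivalent {A H K : Type} [CStarAlgebra A]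
    [NormedAddCommGroup H] [InnerProductSpace ℂ H] [CompleteSpace H]
    [NormedAddCommGroup K] [InnerProductSpace ℂ K] [CompleteSpace K]
    (π : A →⋆ₐ[ℂ] (H →L[ℂ] H)) (ρ : A →⋆ₐ[ℂ] (K →L[ℂ] K)) : Prop :=
  ∃ U : H ≃ₗᵢ[ℂ] K, ∀ a x, U (π a x) = ρ a (U x)

variable {d : ℕ} (P : QData d)

/-- The words equivalent to `α`. -/
abbrev TailClass (α : Word d) : Type := {β : Word d // TailEquiv β α}

lemma posSemidef_classGram (α : Word d) :
    (P.wordGram.submatrix (fun β : TailClass α => β.1) fun β => β.1).PosSemidef :=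
  P.posSemidef_wordGram.submatrix _

/-- The Hilbert space `H_α`: the completion of the span of the `e_β`, `β ∼ α`. -/
abbrev HSpace (α : Word d) : Type := GramSpace (posSemidef_classGram P α)

/-- The vector `e_β` of `H_α`. -/
def HSpace.vec {α : Word d} (β : TailClass α) : HSpace P α :=
  GramSpace.vec (posSemidef_classGram P α) β

open Classical in
/-- `π` is the representation `π_α`: it is given on the vectors `e_β` by
`π(s_j) e_β = e_{σ_j(β)}`, and `π(s_j^*) e_β = q(j, β) e_{β ∖ j}` if `β` contains `j` and
`π(s_j^*) e_β = 0` otherwise. -/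
def IsWordRep (α : Word d) (π : W P →⋆ₐ[ℂ] (HSpace P α →L[ℂ] HSpace P α)) : Prop :=
  ∀ (j : Fin d) (β : TailClass α),
    π (W.s j) (HSpace.vec P β) = HSpace.vec P ⟨Word.cons j β.1, β.2.cons j⟩ ∧
    π (star (W.s j)) (HSpace.vec P β) =
      if β.1.Contains j then
        P.qLetterWord j β.1 • HSpace.vec P ⟨β.1.erase j, β.2.erase j⟩
      else 0

/-- The Fock space: the completion of the span of the `e_μ`, `μ` a finite word. -/
abbrev FockSpace : Type := GramSpace P.posSemidef_fockGram

/-- The vector `e_μ` of the Fock space; `e_∅` is the vacuum vector. -/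
def FockSpace.vec (μ : List (Fin d)) : FockSpace P := GramSpace.vec P.posSemidef_fockGram μ

/-- `π` is the Fock representation: it is given on the vectors `e_μ` by `π(s_j) e_μ = e_{(j, μ)}`,
and `π(s_j^*) e_μ = q(j, μ) e_{μ ∖ j}` if `μ` contains `j` and `π(s_j^*) e_μ = 0` otherwise. -/
def IsFockRep (π : W P →⋆ₐ[ℂ] (FockSpace P →L[ℂ] FockSpace P)) : Prop :=
  ∀ (j : Fin d) (μ : List (Fin d)),
    π (W.s j) (FockSpace.vec P μ) = FockSpace.vec P (j :: μ) ∧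
    π (star (W.s j)) (FockSpace.vec P μ) =
      if j ∈ μ then P.qLetter j μ • FockSpace.vec P (μ.erase j) else 0

end Representations

end QIsom

end

/-! All the representations come from one mechanism. Suppose that on the index set `X` of a Gram
matrix `M` there are insertions `σ_j`, removals `τ_j` and coefficients `c_j` with `M (σ_j x) y =
c_j(y) M x (τ_j y)`. Then `e_x ↦ e_{σ_j x}` and `e_x ↦ c_j(x) e_{τ_j x}` are adjoint to each other,
and combinatorial identities for `σ`, `τ`, `c` turn into the relations of `W`. This is
`IsGramSystem.existsUnique_rep`, applied both to finite words (`isGramSystem_fock`) and to a class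
of infinite words (`isGramSystem_class`). The rule for infinite words follows from the one for
finite words, because scalar products and coefficients can be read off long initial segments.

Everything else rests on the range projections `s_μ s_μ^*` of the initial segments `μ` of an
infinite word `γ`. Remove the letters of `γ` from a word `β` one after the other. If from some step
on the letter to be removed always stands first, the rests of `γ` and `β` coincide. Otherwise
infinitely often a letter has to be moved past another one, and each time the coefficient loses a
factor of modulus at most `r < 1`, so it tends to zero. This dichotomy is
`QData.eraseList_eq_or_tendsto_zero`. Since the projections are uniformly bounded and the `e_β` span
a dense subspace, they converge strongly in `π_α`: to the projection onto `ℂ e_γ` if `γ ∼ α`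
(`IsWordRep.tendsto_rangeProj`), and to `0` if not (`IsWordRep.tendsto_rangeProj_zero`). They also
tend to `0` in the Fock representation, where a finite word runs out of letters.

A nonzero closed invariant subspace therefore contains some `e_γ`, and `s_μ s_ν^*` carries `e_γ` to
any other `e_β`; this gives irreducibility. The strong limit for `γ = α` distinguishes `π_α` from
`π_α'` with `α` and `α'` inequivalent, and from `π_F`. Equivalent words define the same space and
the same operators. The same dichotomy also yields the limit formula for the scalar products. -/

noncomputable section

namespace QIsom

open Filter Topology UniformSpace
open scoped ComplexOrder

/-! ### Universal property of `W` -/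

section UniversalProperty

variable {d : ℕ} {P : QData d} {A : Type} [CStarAlgebra A]

/-- The homomorphism from the free `*`-algebra that sends the generators to the elements `T j`. -/
def FreeStarAlg.eval (T : Fin d → A) : FreeStarAlg d →ₐ[ℂ] A :=
  MonoidAlgebra.lift ℂ A (FreeMonoid (Fin d × Bool))
    (FreeMonoid.lift fun x : Fin d × Bool => if x.2 then T x.1 else star (T x.1))

lemma FreeStarAlg.eval_mono (T : Fin d → A) (w : FreeMonoid (Fin d × Bool)) (c : ℂ) :
    eval T (mono w c) =
      c • FreeMonoid.lift (fun x : Fin d × Bool => if x.2 then T x.1 else star (T x.1)) w :=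
  MonoidAlgebra.lift_single _ _ _

lemma FreeStarAlg.eval_gen (T : Fin d → A) (j : Fin d) : eval T (gen j) = T j := by
  simp [gen, eval_mono]

lemma lift_adjWord (T : Fin d → A) (w : FreeMonoid (Fin d × Bool)) :
    FreeMonoid.lift (fun x : Fin d × Bool => if x.2 then T x.1 else star (T x.1)) (adjWord w) =
      star (FreeMonoid.lift (fun x : Fin d × Bool => if x.2 then T x.1 else star (T x.1)) w) := by
  induction w using FreeMonoid.inductionOn' with
  | one => rw [show adjWord (1 : FreeMonoid (Fin d × Bool)) = 1 from rfl, map_one, star_one]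
  | of_mul x w ih =>
    have h : adjWord (FreeMonoid.of x) = FreeMonoid.of (x.1, !x.2) := rfl
    obtain ⟨i, b⟩ := x
    rw [adjWord_mul, map_mul, map_mul, star_mul, ih, h]
    cases b <;> simp

lemma FreeStarAlg.eval_star (T : Fin d → A) (x : FreeStarAlg d) :
    eval T (star x) = star (eval T x) := by
  induction x using FreeStarAlg.induction with
  | zero => simp
  | plus x y hx hy => simp only [star_add, map_add, hx, hy]
  | mono w c =>
    rw [star_mono, eval_mono, eval_mono, lift_adjWord, star_smul]
    rfl

variable (P) in
/-- The relations between the generators of `W`. -/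
structure SatisfiesRelations (T : Fin d → A) : Prop where
  isometry : ∀ i, star (T i) * T i = 1
  commutation : ∀ i j, i ≠ j → star (T i) * T j = P.q i j • (T j * star (T i))

/-- The norm of `A` pulled back along `FreeStarAlg.eval T` is a `C^*`-seminorm that kills the
relations, so the largest such seminorm dominates it. This is the bound needed to extend the
evaluation to the completion. -/
lemma SatisfiesRelations.norm_eval_le {T : Fin d → A} (hT : SatisfiesRelations P T)
    (x : FreeStarAlg d) : ‖FreeStarAlg.eval T x‖ ≤ univNorm P x := by
  let p : Seminorm ℂ (FreeStarAlg d) :=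
    (normSeminorm ℂ A).comp (FreeStarAlg.eval T).toLinearMap
  have hp : IsCStarSeminorm P p :=
    { map_mul_le := fun x y => by
        change ‖FreeStarAlg.eval T (x * y)‖ ≤ ‖FreeStarAlg.eval T x‖ * ‖FreeStarAlg.eval T y‖
        rw [map_mul]
        exact norm_mul_le _ _
      map_star_mul_self := fun x => by
        change ‖FreeStarAlg.eval T (star x * x)‖ =
          ‖FreeStarAlg.eval T x‖ * ‖FreeStarAlg.eval T x‖
        rw [map_mul, FreeStarAlg.eval_star, CStarRing.norm_star_mul_self]
      isometry := fun i => by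
        change ‖FreeStarAlg.eval T _‖ = 0
        rw [map_sub, map_mul, FreeStarAlg.eval_star, FreeStarAlg.eval_gen, hT.isometry, map_one,
          sub_self, norm_zero]
      commutation := fun i j hij => by
        change ‖FreeStarAlg.eval T _‖ = 0
        rw [map_sub, map_mul, map_smul, map_mul, FreeStarAlg.eval_star, FreeStarAlg.eval_gen,
          FreeStarAlg.eval_gen, hT.commutation i j hij, sub_self, norm_zero] }
  exact hp.le_univNorm x

/-- Elements of a `C^*`-algebra that satisfy the relations are the images of the generators under
a `*`-homomorphism from `W`. -/
lemma SatisfiesRelations.exists_starAlgHom {T : Fin d → A} (hT : SatisfiesRelations P T) :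
    ∃ π : W P →⋆ₐ[ℂ] A, ∀ j, π (W.s j) = T j := by
  let e : PreW P →+* A := (FreeStarAlg.eval T).toRingHom
  have he : Continuous e :=
    AddMonoidHomClass.continuous_of_bound e 1 fun x => by
      rw [one_mul]
      exact hT.norm_eval_le x
  let f : W P →+* A := Completion.extensionHom e he
  have hfc : Continuous f := Completion.continuous_extension
  have hf : ∀ x : PreW P, f (W.of x) = FreeStarAlg.eval T x :=
    fun x => Completion.extensionHom_coe e he x
  have hsmul : ∀ (c : ℂ) (x : W P), f (c • x) = c • f x := fun c x => by
    induction x using W.induction with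
    | closed =>
      exact isClosed_eq (hfc.comp (continuous_const_smul c)) (hfc.const_smul c)
    | of x => rw [← W.of_smul, hf, hf]; exact map_smul (FreeStarAlg.eval T) c x
  have hstar : ∀ x : W P, f (star x) = star (f x) := fun x => by
    induction x using W.induction with
    | closed =>
      exact isClosed_eq (hfc.comp (W.continuous_star' P)) hfc.star
    | of x => rw [← W.of_star, hf, hf]; exact FreeStarAlg.eval_star T x
  refine ⟨{ f with
    commutes' := fun c => ?_
    map_star' := hstar }, fun j => (hf _).trans (FreeStarAlg.eval_gen T j)⟩
  change f (algebraMap ℂ (W P) c) = _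
  rw [Algebra.algebraMap_eq_smul_one, hsmul, map_one, Algebra.algebraMap_eq_smul_one]

variable (P) in
/-- The canonical homomorphism from the free `*`-algebra to `W`. -/
def FreeStarAlg.toW : FreeStarAlg d →⋆ₐ[ℂ] W P where
  toFun x := W.of (x : PreW P)
  map_one' := Completion.coe_one (PreW P)
  map_mul' := W.of_mul P
  map_zero' := Completion.coe_zero
  map_add' := W.of_add P
  commutes' c := by
    rw [Algebra.algebraMap_eq_smul_one, Algebra.algebraMap_eq_smul_one]
    refine (W.of_smul P c 1).trans (congrArg (c • ·) ?_)
    exact Completion.coe_one (PreW P)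
  map_star' := W.of_star P

lemma FreeStarAlg.norm_toW (x : FreeStarAlg d) : ‖toW P x‖ = univNorm P x := W.norm_of P x

lemma FreeStarAlg.toW_gen (j : Fin d) : toW P (gen j) = W.s j := rfl

lemma FreeStarAlg.starAlgHom_ext {φ ψ : FreeStarAlg d →⋆ₐ[ℂ] A}
    (h : ∀ j, φ (gen j) = ψ (gen j)) (x : FreeStarAlg d) : φ x = ψ x := by
  induction x using FreeStarAlg.induction with
  | zero => simp
  | plus x y hx hy => rw [map_add, map_add, hx, hy]
  | mono w c =>
    have h1 : mono w c = c • mono w 1 := by rw [smul_mono, mul_one]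
    rw [h1, map_smul, map_smul]
    congr 1
    clear h1
    induction w using FreeMonoid.inductionOn' with
    | one => rw [← one_eq, map_one, map_one]
    | of_mul x w ih =>
      have h2 : mono (FreeMonoid.of x * w) 1 = mono (FreeMonoid.of x) 1 * mono w 1 := by
        rw [mono_mul_mono, one_mul]
      rw [h2, map_mul, map_mul, ih]
      congr 1
      obtain ⟨i, b⟩ := x
      cases b with
      | true => exact h i
      | false => rw [← star_gen, map_star, map_star, h]

lemma W.continuous_starAlgHom (π : W P →⋆ₐ[ℂ] A) : Continuous π :=
  AddMonoidHomClass.continuous_of_bound π 1 fun x => by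
    rw [one_mul]
    exact NonUnitalStarAlgHom.norm_apply_le π x

/-- `*`-homomorphisms on `W` that agree on the generators are equal. -/
lemma W.starAlgHom_ext {π ρ : W P →⋆ₐ[ℂ] A} (h : ∀ j, π (W.s j) = ρ (W.s j)) : π = ρ := by
  ext x
  induction x using W.induction with
  | closed => exact isClosed_eq (W.continuous_starAlgHom π) (W.continuous_starAlgHom ρ)
  | of x =>
    exact FreeStarAlg.starAlgHom_ext (φ := π.comp (FreeStarAlg.toW P))
      (ψ := ρ.comp (FreeStarAlg.toW P)) h x

/-- The differences of the two sides of the relations have seminorm zero, and the completion is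
Hausdorff. -/
lemma W.satisfiesRelations : SatisfiesRelations P (W.s (P := P)) where
  isometry i := by
    have h := (FreeStarAlg.norm_toW _).trans ((isCStarSeminorm_univSeminorm P).isometry i)
    rwa [norm_eq_zero, map_sub, map_mul, map_star, map_one, FreeStarAlg.toW_gen, sub_eq_zero] at h
  commutation i j hij := by
    have h := (FreeStarAlg.norm_toW _).trans
      ((isCStarSeminorm_univSeminorm P).commutation i j hij)
    rwa [norm_eq_zero, map_sub, map_mul, map_smul, map_mul, map_star, FreeStarAlg.toW_gen,
      FreeStarAlg.toW_gen, sub_eq_zero] at h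

lemma W.norm_s_le (j : Fin d) : ‖(W.s j : W P)‖ ≤ 1 :=
  (W.norm_of P _).trans_le ((isCStarSeminorm_univSeminorm P).map_gen_le j)

lemma W.norm_one_le : ‖(1 : W P)‖ ≤ 1 := by
  rw [← map_one (FreeStarAlg.toW P), FreeStarAlg.norm_toW]
  exact (isCStarSeminorm_univSeminorm P).map_one_le

end UniversalProperty

/-! ### Operators on the Hilbert space of a Gram matrix -/

section GramSpaces

variable {X : Type} {M : Matrix X X ℂ} (hM : M.PosSemidef)
  {H : Type} [NormedAddCommGroup H] [InnerProductSpace ℂ H]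

lemma GramSpace.span_range_vec :
    Submodule.span ℂ (Set.range (PreGram.vec hM)) = ⊤ := by
  refine eq_top_iff.mpr fun f _ => ?_
  induction f using Finsupp.induction_linear with
  | zero => exact Submodule.zero_mem _
  | add f g hf hg => exact Submodule.add_mem _ (hf trivial) (hg trivial)
  | single x a =>
    have h : (Finsupp.single x a : X →₀ ℂ) = a • (Finsupp.single x (1 : ℂ) : X →₀ ℂ) := by simp
    rw [h]
    exact Submodule.smul_mem _ a (Submodule.subset_span ⟨x, rfl⟩)

/-- A closed subspace that contains the vectors `e_x` is the whole space. -/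
lemma GramSpace.eq_top_of_vec_mem (K : Submodule ℂ (GramSpace hM))
    (hK : IsClosed (K : Set (GramSpace hM))) (h : ∀ x, vec hM x ∈ K) : K = ⊤ := by
  refine (Submodule.eq_top_iff').mpr fun v => ?_
  induction v using Completion.induction_on with
  | hp => exact hK
  | ih f =>
    have hf : f ∈ Submodule.span ℂ (Set.range (PreGram.vec hM)) := by
      rw [span_range_vec]; trivial
    induction hf using Submodule.span_induction with
    | mem f hf => obtain ⟨x, rfl⟩ := hf; exact h x
    | zero => rw [Completion.coe_zero]; exact K.zero_mem
    | add f g _ _ hf hg => rw [Completion.coe_add]; exact K.add_mem hf hg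
    | smul a f _ hf => rw [Completion.coe_smul]; exact K.smul_mem a hf

variable {hM} in
lemma GramSpace.clm_ext {S T : GramSpace hM →L[ℂ] H} (h : ∀ x, S (vec hM x) = T (vec hM x)) :
    S = T := by
  have hK := eq_top_of_vec_mem hM (LinearMap.eqLocus (S : GramSpace hM →ₗ[ℂ] H) T)
    (isClosed_eq S.continuous T.continuous) h
  ext v
  have hv : v ∈ LinearMap.eqLocus (S : GramSpace hM →ₗ[ℂ] H) T := by rw [hK]; trivial
  exact hv

variable {hM} in
lemma GramSpace.ext_inner_vec {u v : GramSpace hM}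
    (h : ∀ x, inner ℂ (vec hM x) u = inner ℂ (vec hM x) v) : u = v := by
  have h2 : innerSL ℂ u = innerSL ℂ v := clm_ext fun x => by
    rw [innerSL_apply_apply, innerSL_apply_apply, ← inner_conj_symm, h, inner_conj_symm]
  refine ext_inner_right ℂ fun w => ?_
  simpa using congrArg (fun T => T w) h2

/-- Vectors of a Hilbert space with scalar products `M` are the images of the `e_x` under a bounded
operator. -/
lemma GramSpace.exists_clm [CompleteSpace H] (v : X → H) (h : ∀ x y, inner ℂ (v x) (v y) = M x y) :
    ∃ V : GramSpace hM →L[ℂ] H, ∀ x, V (vec hM x) = v x := by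
  -- The form may be degenerate, so the map is defined on formal combinations. It preserves the
  -- form, hence is bounded by `1` and extends to the Hausdorff completion.
  let f : PreGram hM →ₗ[ℂ] H := Finsupp.linearCombination ℂ v
  have hform : ∀ a : X →₀ ℂ, inner ℂ (Finsupp.linearCombination ℂ v a)
      (Finsupp.linearCombination ℂ v a) = PreGram.form a a M := fun a => by
    simp only [Finsupp.linearCombination_apply, Finsupp.sum, sum_inner, inner_sum,
      inner_smul_left, inner_smul_right, h, PreGram.form]
    rw [Finset.sum_comm]
    refine Finset.sum_congr rfl fun x _ => ?_
    rw [Finset.mul_sum]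
    exact Finset.sum_congr rfl fun y _ => by ring
  have hin : ∀ a, inner ℂ (f a) (f a) = inner ℂ a a := hform
  have hn : ∀ a, ‖f a‖ ≤ 1 * ‖a‖ := fun a => by
    rw [one_mul, norm_eq_sqrt_re_inner (𝕜 := ℂ),
      norm_eq_sqrt_re_inner (𝕜 := ℂ) (E := PreGram hM), hin]
  let F : PreGram hM →L[ℂ] H := f.mkContinuous 1 hn
  refine ⟨F.extend (Completion.toComplL : PreGram hM →L[ℂ] GramSpace hM), fun x => ?_⟩
  refine (ContinuousLinearMap.extend_eq F Completion.denseRange_coe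
    (Completion.isUniformInducing_coe _) _).trans ?_
  change Finsupp.linearCombination ℂ v (Finsupp.single x 1) = v x
  simp

/-- A bounded sequence of operators that converges on the vectors `e_x` converges strongly. -/
lemma GramSpace.tendsto_of_vec {T : ℕ → GramSpace hM →L[ℂ] H} {L : GramSpace hM →L[ℂ] H}
    (hT : ∀ m, ‖T m‖ ≤ 1) (h : ∀ x, Tendsto (fun m => T m (vec hM x)) atTop (𝓝 (L (vec hM x))))
    (v : GramSpace hM) : Tendsto (fun m => T m v) atTop (𝓝 (L v)) := by
  let K : Submodule ℂ (GramSpace hM) :=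
    { carrier := {v | Tendsto (fun m => T m v) atTop (𝓝 (L v))}
      zero_mem' := by simp
      add_mem' := fun {u v} hu hv => by
        simp only [Set.mem_ofPred_eq, map_add] at *
        exact hu.add hv
      smul_mem' := fun c v hv => by
        simp only [Set.mem_ofPred_eq, map_smul] at *
        exact hv.const_smul c }
  -- All `T m` are Lipschitz with constant `1`; equicontinuity makes the set of vectors where
  -- convergence holds closed.
  have hE : Equicontinuous fun m => (T m : GramSpace hM → H) := by
    refine (LipschitzWith.uniformEquicontinuous _ 1 fun m => ?_).equicontinuous
    exact (T m).lipschitz.weaken (hT m)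
  have hK := eq_top_of_vec_mem hM K (hE.isClosed_setOfPred_tendsto L.continuous) h
  have hv : v ∈ K := by rw [hK]; trivial
  exact hv

end GramSpaces

/-! ### Representations from insertion and removal maps -/

section GramRepresentations

variable {d : ℕ} (P : QData d) {X : Type} {M : Matrix X X ℂ} (hM : M.PosSemidef)

/-- Maps `σ_j`, `τ_j` of the index set and coefficients `c_j` such that `e_x ↦ e_{σ_j x}` and
`e_x ↦ c_j(x) e_{τ_j x}` are adjoint to each other and satisfy the relations. -/
structure IsGramSystem (M : Matrix X X ℂ) (σ τ : Fin d → X → X) (c : Fin d → X → ℂ) : Prop where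
  gram : ∀ j x y, M (σ j x) y = c j y * M x (τ j y)
  coeff_self : ∀ j x, c j (σ j x) = 1
  remove_self : ∀ j x, τ j (σ j x) = x
  coeff_ne : ∀ i j x, i ≠ j → c i (σ j x) = P.q i j * c i x
  remove_ne : ∀ i j x, i ≠ j → τ i (σ j x) = σ j (τ i x)

variable {P} {σ τ : Fin d → X → X} {c : Fin d → X → ℂ}

/-- The representation of `W` given by such maps. -/
lemma IsGramSystem.existsUnique_rep (hs : IsGramSystem P M σ τ c) :
    ∃! π : W P →⋆ₐ[ℂ] (GramSpace hM →L[ℂ] GramSpace hM), ∀ j x,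
      π (W.s j) (GramSpace.vec hM x) = GramSpace.vec hM (σ j x) ∧
      π (star (W.s j)) (GramSpace.vec hM x) = c j x • GramSpace.vec hM (τ j x) := by
  have h1 : ∀ j, ∃ V : GramSpace hM →L[ℂ] GramSpace hM,
      ∀ x, V (GramSpace.vec hM x) = GramSpace.vec hM (σ j x) := fun j =>
    -- Insertion preserves scalar products: `M (σ x) (σ y) = c (σ y) * M x (τ (σ y)) = M x y`.
    GramSpace.exists_clm hM (fun x => GramSpace.vec hM (σ j x)) fun x y => by
      rw [GramSpace.inner_vec, hs.gram, hs.coeff_self, hs.remove_self, one_mul]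
  choose T hT using h1
  have hT' : ∀ j x, star (T j) (GramSpace.vec hM x) = c j x • GramSpace.vec hM (τ j x) :=
    fun j x => GramSpace.ext_inner_vec fun y => by
      rw [ContinuousLinearMap.star_eq_adjoint, ContinuousLinearMap.adjoint_inner_right, hT,
        inner_smul_right, GramSpace.inner_vec, GramSpace.inner_vec, hs.gram]
  have hrel : SatisfiesRelations P T :=
    { isometry := fun i => GramSpace.clm_ext fun x => by
        rw [mul_apply_eq_comp, hT, hT', hs.coeff_self, hs.remove_self, one_smul]
        rfl
      commutation := fun i j hij => GramSpace.clm_ext fun x => by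
        rw [mul_apply_eq_comp, hT, hT', hs.coeff_ne _ _ _ hij, hs.remove_ne _ _ _ hij,
          smul_apply, mul_apply_eq_comp, hT', map_smul, hT,
          smul_smul] }
  obtain ⟨π, hπ⟩ := hrel.exists_starAlgHom
  refine ⟨π, fun j x => ⟨by rw [hπ, hT], by rw [map_star, hπ, hT']⟩, fun ρ hρ => ?_⟩
  refine W.starAlgHom_ext fun j => GramSpace.clm_ext fun x => ?_
  rw [(hρ j x).1, hπ, hT]

end GramRepresentations

/-! ### Products of generators and their range projections -/

section GramSystems

variable {d : ℕ} {P : QData d} {X : Type} {M : Matrix X X ℂ}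
  {σ τ : Fin d → X → X} {c : Fin d → X → ℂ}

/-- `τ_μ x`: the maps `τ_j` applied one after the other, for the letters `j` of `μ`. -/
def removeList (τ : Fin d → X → X) : List (Fin d) → X → X
  | [], x => x
  | j :: μ, x => removeList τ μ (τ j x)

/-- `σ_μ x`, with the first letter of `μ` applied last. -/
def insertList (σ : Fin d → X → X) : List (Fin d) → X → X
  | [], x => x
  | j :: μ, x => σ j (insertList σ μ x)

/-- The coefficient of `s_μ^* e_x`. -/
def coeffList (τ : Fin d → X → X) (c : Fin d → X → ℂ) : List (Fin d) → X → ℂ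
  | [], _ => 1
  | j :: μ, x => c j x * coeffList τ c μ (τ j x)

lemma removeList_append (τ : Fin d → X → X) (μ ν : List (Fin d)) (x : X) :
    removeList τ (μ ++ ν) x = removeList τ ν (removeList τ μ x) := by
  induction μ generalizing x with
  | nil => rfl
  | cons j μ ih => exact ih _

lemma coeffList_append (τ : Fin d → X → X) (c : Fin d → X → ℂ) (μ ν : List (Fin d)) (x : X) :
    coeffList τ c (μ ++ ν) x = coeffList τ c μ x * coeffList τ c ν (removeList τ μ x) := by
  induction μ generalizing x with
  | nil => simp [coeffList, removeList]
  | cons j μ ih => rw [List.cons_append, coeffList, coeffList, ih, mul_assoc]; rfl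

/-- The adjointness of `σ_j` and `τ_j`, iterated over the letters of `μ`. -/
lemma IsGramSystem.gram_insertList (hs : IsGramSystem P M σ τ c) (μ : List (Fin d)) (x y : X) :
    M (insertList σ μ x) y = coeffList τ c μ y * M x (removeList τ μ y) := by
  induction μ generalizing y with
  | nil => simp [coeffList, removeList, insertList]
  | cons j μ ih => rw [insertList, hs.gram, ih, coeffList, removeList, mul_assoc]

lemma IsGramSystem.coeffList_insertList (hs : IsGramSystem P M σ τ c) (μ : List (Fin d)) (x : X) :
    coeffList τ c μ (insertList σ μ x) = 1 := by
  induction μ with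
  | nil => rfl
  | cons j μ ih =>
    rw [insertList, coeffList, hs.coeff_self, hs.remove_self, ih, one_mul]

lemma IsGramSystem.removeList_insertList (hs : IsGramSystem P M σ τ c) (μ : List (Fin d)) (x : X) :
    removeList τ μ (insertList σ μ x) = x := by
  induction μ with
  | nil => rfl
  | cons j μ ih => rw [insertList, removeList, hs.remove_self, ih]

variable (P) in
/-- `s_μ`, the product of the generators `s_j` over the letters `j` of `μ`. -/
def W.sWord (μ : List (Fin d)) : W P := (μ.map W.s).prod

lemma W.norm_sWord_le (μ : List (Fin d)) : ‖W.sWord P μ‖ ≤ 1 := by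
  induction μ with
  | nil => exact W.norm_one_le
  | cons j μ ih =>
    rw [W.sWord, List.map_cons, List.prod_cons]
    exact (norm_mul_le _ _).trans (mul_le_one₀ (W.norm_s_le j) (norm_nonneg _) ih)

variable (P) in
/-- The range projection `s_μ s_μ^*`. -/
def W.rangeProj (μ : List (Fin d)) : W P := W.sWord P μ * star (W.sWord P μ)

lemma W.norm_rangeProj_le (μ : List (Fin d)) : ‖W.rangeProj P μ‖ ≤ 1 := by
  refine (norm_mul_le _ _).trans (mul_le_one₀ (W.norm_sWord_le μ) (norm_nonneg _) ?_)
  rw [norm_star]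
  exact W.norm_sWord_le μ

variable {hM : M.PosSemidef}

/-- `π` acts on the vectors `e_x` by the maps `σ`, `τ` and the coefficients `c`. -/
def IsGramRep (hM : M.PosSemidef) (σ τ : Fin d → X → X) (c : Fin d → X → ℂ)
    (π : W P →⋆ₐ[ℂ] (GramSpace hM →L[ℂ] GramSpace hM)) : Prop :=
  ∀ j x, π (W.s j) (GramSpace.vec hM x) = GramSpace.vec hM (σ j x) ∧
    π (star (W.s j)) (GramSpace.vec hM x) = c j x • GramSpace.vec hM (τ j x)

variable {π : W P →⋆ₐ[ℂ] (GramSpace hM →L[ℂ] GramSpace hM)}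

lemma IsGramRep.sWord_vec (hπ : IsGramRep hM σ τ c π) (μ : List (Fin d)) (x : X) :
    π (W.sWord P μ) (GramSpace.vec hM x) = GramSpace.vec hM (insertList σ μ x) := by
  induction μ with
  | nil => rw [W.sWord, List.map_nil, List.prod_nil, map_one]; rfl
  | cons j μ ih =>
    rw [W.sWord, List.map_cons, List.prod_cons, map_mul, mul_apply_eq_comp]
    exact (congrArg _ ih).trans (hπ _ _).1

lemma IsGramRep.star_sWord_vec (hπ : IsGramRep hM σ τ c π) (μ : List (Fin d)) (x : X) :
    π (star (W.sWord P μ)) (GramSpace.vec hM x) =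
      coeffList τ c μ x • GramSpace.vec hM (removeList τ μ x) := by
  induction μ generalizing x with
  | nil =>
    rw [W.sWord, List.map_nil, List.prod_nil, star_one, map_one, coeffList, one_smul]
    rfl
  | cons j μ ih =>
    rw [W.sWord, List.map_cons, List.prod_cons, star_mul, map_mul, mul_apply_eq_comp, (hπ _ _).2,
      map_smul, coeffList, removeList, ← smul_smul]
    exact congrArg _ (ih _)

lemma IsGramRep.rangeProj_vec (hπ : IsGramRep hM σ τ c π) (μ : List (Fin d)) (x : X) :
    π (W.rangeProj P μ) (GramSpace.vec hM x) =
      coeffList τ c μ x • GramSpace.vec hM (insertList σ μ (removeList τ μ x)) := by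
  rw [W.rangeProj, map_mul, mul_apply_eq_comp, hπ.star_sWord_vec, map_smul, hπ.sWord_vec]

/-- If the coefficients tend to zero, the range projections tend to zero strongly. -/
lemma IsGramRep.tendsto_rangeProj_zero (hπ : IsGramRep hM σ τ c π) (μ : ℕ → List (Fin d))
    (hnorm : ∀ x, ‖GramSpace.vec hM x‖ ≤ 1)
    (h : ∀ x, Tendsto (fun m => coeffList τ c (μ m) x) atTop (𝓝 0)) (v : GramSpace hM) :
    Tendsto (fun m => π (W.rangeProj P (μ m)) v) atTop (𝓝 0) := by
  refine GramSpace.tendsto_of_vec hM (L := 0) (fun m =>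
    (NonUnitalStarAlgHom.norm_apply_le π _).trans (W.norm_rangeProj_le _)) (fun x => ?_) v
  refine squeeze_zero_norm (fun m => ?_) (by simpa using (h x).norm)
  rw [hπ.rangeProj_vec, norm_smul]
  exact mul_le_of_le_one_right (norm_nonneg _) (hnorm _)

end GramSystems

/-! ### The Fock system of finite words -/

section FockSystem

variable {d : ℕ} (P : QData d)

/-- The coefficient of `s_j^* e_μ` in the Fock representation. -/
def QData.fockCoeff (j : Fin d) (μ : List (Fin d)) : ℂ := if j ∈ μ then P.qLetter j μ else 0

/-- The adjointness is the recursion `q((j, μ), ν) = q(j, ν) q(μ, ν ∖ j)` together with the fact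
that `(j, μ)` is a permutation of `ν` exactly when `ν` contains `j` and `μ` is a permutation of `ν ∖
j`. -/
lemma isGramSystem_fock :
    IsGramSystem P P.fockGram List.cons (fun j μ => μ.erase j) P.fockCoeff where
  gram j μ ν := by
    simp only [QData.fockGram, QData.fockCoeff, Matrix.of_apply, List.cons_perm_iff_perm_erase]
    by_cases hj : j ∈ ν <;> by_cases hp : μ.Perm (ν.erase j) <;> simp [hj, hp, QData.qWord]
  coeff_self j μ := by simp [QData.fockCoeff, QData.qLetter]
  remove_self j μ := by simp
  coeff_ne i j μ hij := by
    simp [QData.fockCoeff, QData.qLetter, hij, hij.symm]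
  remove_ne i j μ hij := List.erase_cons_tail (by simpa using hij.symm)

/-- Every removal with nonzero coefficient uses up a letter of `ν`, and there are not enough of
them. This is what makes the range projections of long words vanish on each Fock vector `e_ν`. -/
lemma coeffList_fock_eq_zero (μ ν : List (Fin d)) (h : ν.length < μ.length) :
    coeffList (fun j (μ : List (Fin d)) => μ.erase j) P.fockCoeff μ ν = 0 := by
  induction μ generalizing ν with
  | nil => simp at h
  | cons j μ ih =>
    rw [coeffList]
    by_cases hj : j ∈ ν
    · rw [ih, mul_zero]
      have := List.length_erase_add_one hj
      rw [List.length_cons] at h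
      omega
    · rw [QData.fockCoeff, if_neg hj, zero_mul]

end FockSystem

/-! ### The system of infinite words -/

section InfiniteWords

variable {d : ℕ} (P : QData d)

/-- The word without its first `m` letters. -/
def Word.drop (β : Word d) (m : ℕ) : Word d := fun k => β (m + k)

lemma Word.cons_drop_one (β : Word d) : Word.cons (β 0) (β.drop 1) = β := by
  funext k
  cases k with
  | zero => rfl
  | succ k => exact congrArg β (add_comm 1 k)

lemma Word.eq_cons (β : Word d) : ∃ i β', β = Word.cons i β' := ⟨_, _, β.cons_drop_one.symm⟩

lemma Word.take_cons (j : Fin d) (β : Word d) (m : ℕ) :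
    (Word.cons j β).take (m + 1) = j :: β.take m := by
  simp only [Word.take, List.range_succ_eq_map, List.map_cons, List.map_map]
  rfl

lemma Word.contains_cons {i j : Fin d} {β : Word d} :
    (Word.cons j β).Contains i ↔ j = i ∨ β.Contains i := by
  constructor
  · rintro ⟨k, hk⟩
    cases k with
    | zero => exact Or.inl hk
    | succ k => exact Or.inr ⟨k, hk⟩
  · rintro (h | ⟨k, hk⟩)
    · exact ⟨0, h⟩
    · exact ⟨k + 1, hk⟩

lemma Word.erase_cons_self (j : Fin d) (β : Word d) : (Word.cons j β).erase j = β :=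
  funext fun n => if_pos ⟨0, n.zero_le, rfl⟩

lemma Word.erase_cons_ne {i j : Fin d} (h : i ≠ j) (β : Word d) :
    (Word.cons j β).erase i = Word.cons j (β.erase i) := by
  funext n
  cases n with
  | zero =>
    refine if_neg ?_
    rintro ⟨k, hk, hk'⟩
    obtain rfl : k = 0 := by omega
    exact h hk'.symm
  | succ n =>
    have h1 : (∃ k ≤ n + 1, Word.cons j β k = i) ↔ ∃ k ≤ n, β k = i := by
      constructor
      · rintro ⟨k, hk, hk'⟩
        cases k with
        | zero => exact absurd hk'.symm h
        | succ k => exact ⟨k, by omega, hk'⟩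
      · rintro ⟨k, hk, hk'⟩
        exact ⟨k + 1, by omega, hk'⟩
    simp only [Word.erase, h1]
    rfl

lemma Word.mem_take {β : Word d} {j : Fin d} {m : ℕ} : j ∈ β.take m ↔ ∃ k < m, β k = j := by
  simp [Word.take]

open Classical in
/-- The coefficient of `s_j^* e_β`. -/
def QData.coeff (j : Fin d) (β : Word d) : ℂ := if β.Contains j then P.qLetterWord j β else 0

lemma QData.qLetterWord_eq {j : Fin d} {β : Word d} {n : ℕ} (hn : β n = j)
    (h : ∀ k < n, β k ≠ j) : P.qLetterWord j β = ∏ k ∈ Finset.range n, P.q j (β k) := by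
  have h1 : sInf {k | β k = j} = n :=
    IsLeast.csInf_eq ⟨hn, fun k hk => by by_contra! h2; exact h k h2 hk⟩
  rw [QData.qLetterWord, h1]

lemma QData.coeff_cons_self (j : Fin d) (β : Word d) : P.coeff j (Word.cons j β) = 1 := by
  rw [QData.coeff, if_pos (Word.contains_cons.mpr (Or.inl rfl)),
    P.qLetterWord_eq (n := 0) (show Word.cons j β 0 = j from rfl) (by simp)]
  simp

lemma QData.coeff_cons_ne {i j : Fin d} (hij : i ≠ j) (β : Word d) :
    P.coeff i (Word.cons j β) = P.q i j * P.coeff i β := by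
  classical
  by_cases h : β.Contains i
  · rw [QData.coeff, QData.coeff, if_pos h, if_pos (Word.contains_cons.mpr (Or.inr h)),
      P.qLetterWord_eq (Nat.find_spec h) fun k hk => Nat.find_min h hk,
      P.qLetterWord_eq (n := Nat.find h + 1) (Nat.find_spec h), Finset.prod_range_succ',
      mul_comm]
    · rfl
    · intro k hk
      cases k with
      | zero => exact hij.symm
      | succ k => exact Nat.find_min h (by omega)
  · rw [QData.coeff, QData.coeff, if_neg h, if_neg, mul_zero]
    rw [Word.contains_cons]
    exact not_or.mpr ⟨hij.symm, h⟩

lemma QData.coeff_eq_zero {j : Fin d} {β : Word d} (h : ¬ β.Contains j) : P.coeff j β = 0 :=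
  if_neg h

/-- Only the letters up to the first `j` matter, so an initial segment that contains `j` determines
the coefficient. The removal shortens the segment by one letter, whence `m + 1` against `m`. -/
lemma QData.coeff_eq_qLetter {j : Fin d} {β : Word d} {m : ℕ} (h : j ∈ β.take (m + 1)) :
    P.coeff j β = P.qLetter j (β.take (m + 1)) ∧
      (β.take (m + 1)).erase j = (β.erase j).take m := by
  induction m generalizing β with
  | zero =>
    obtain ⟨i, β, rfl⟩ := β.eq_cons
    rw [Word.take_cons] at h ⊢
    obtain rfl : j = i := by simpa [Word.take] using h
    rw [P.coeff_cons_self, Word.erase_cons_self]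
    simp [QData.qLetter, Word.take]
  | succ m ih =>
    obtain ⟨i, β, rfl⟩ := β.eq_cons
    rw [Word.take_cons] at h ⊢
    by_cases hij : j = i
    · subst hij
      rw [P.coeff_cons_self, Word.erase_cons_self]
      simp [QData.qLetter]
    · obtain ⟨h1, h2⟩ := ih ((List.mem_cons.mp h).resolve_left hij)
      rw [P.coeff_cons_ne hij, Word.erase_cons_ne hij, Word.take_cons, QData.qLetter,
        if_neg (Ne.symm hij), h1, List.erase_cons_tail (by simpa using Ne.symm hij), h2]
      exact ⟨rfl, rfl⟩

lemma QData.wordGram_eq_zero {γ β : Word d} (h : ¬ ∃ m, ∀ k, m ≤ k → γ k = β k) :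
    P.wordGram γ β = 0 := by
  rw [QData.wordGram, Matrix.of_apply, dif_neg h]

lemma QData.wordGram_self (β : Word d) : P.wordGram β β = 1 := by
  rw [P.wordGram_eq (m := 0) fun _ _ => rfl]
  simp [Word.take, QData.fockGram, QData.qWord]

lemma Word.erase_apply_of_mem {β : Word d} {j : Fin d} {m k : ℕ} (h : j ∈ β.take m)
    (hk : m ≤ k) : β.erase j k = β (k + 1) := by
  obtain ⟨l, hl, hl'⟩ := Word.mem_take.mp h
  exact if_pos ⟨l, by omega, hl'⟩

/-- Adjointness is inherited from the Fock system by passing to initial segments so long that the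
words agree beyond them and that they contain the first `j` of `β`, if there is one. -/
lemma QData.wordGram_cons (j : Fin d) (γ β : Word d) :
    P.wordGram (Word.cons j γ) β = P.coeff j β * P.wordGram γ (β.erase j) := by
  by_cases hj : β.Contains j
  · obtain ⟨l, hl⟩ := hj
    by_cases h : ∃ m, ∀ k, m ≤ k → Word.cons j γ k = β k
    · obtain ⟨m, hm⟩ := h
      have hmem : j ∈ β.take (m + l + 1) := Word.mem_take.mpr ⟨l, by omega, hl⟩
      have h1 : ∀ k, m + l + 1 ≤ k → γ k = β.erase j k := fun k hk => by
        rw [Word.erase_apply_of_mem hmem hk, ← hm (k + 1) (by omega)]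
        rfl
      have hmem' : j ∈ β.take (m + l + 1 + 1) := Word.mem_take.mpr ⟨l, by omega, hl⟩
      obtain ⟨h2, h3⟩ := P.coeff_eq_qLetter hmem'
      rw [P.wordGram_eq h1, P.wordGram_eq (m := m + l + 1 + 1) fun k hk => hm k (by omega),
        Word.take_cons, (isGramSystem_fock P).gram, h3, h2, QData.fockCoeff, if_pos hmem']
    · rw [P.wordGram_eq_zero h, P.wordGram_eq_zero, mul_zero]
      rintro ⟨m, hm⟩
      -- Beyond the place `l` of a letter `j`, removing `j` from `β` is a shift by one, and so is
      -- inserting `j` in `γ`. Agreement of `γ` and `β ∖ j` from some place on would thus give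
      -- agreement of `σ_j(γ)` and `β`.
      refine h ⟨m + l + 2, fun k hk => ?_⟩
      obtain ⟨k, rfl⟩ : ∃ k', k = k' + 1 := ⟨k - 1, by omega⟩
      have hmem : j ∈ β.take (l + 1) := Word.mem_take.mpr ⟨l, by omega, hl⟩
      rw [← Word.erase_apply_of_mem hmem (by omega), ← hm k (by omega)]
      rfl
  · rw [P.coeff_eq_zero hj, zero_mul]
    by_cases h : ∃ m, ∀ k, m ≤ k → Word.cons j γ k = β k
    · obtain ⟨m, hm⟩ := h
      -- The words agree from `m` on, but `β` lacks `j`: the Fock coefficient of the initial segment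
      -- is zero.
      rw [P.wordGram_eq (m := m + 1) fun k hk => hm k (by omega), Word.take_cons,
        (isGramSystem_fock P).gram, QData.fockCoeff, if_neg, zero_mul]
      rw [Word.mem_take]
      rintro ⟨k, _, hk⟩
      exact hj ⟨k, hk⟩
    · exact P.wordGram_eq_zero h

lemma isGramSystem_word :
    IsGramSystem P P.wordGram Word.cons (fun j β => β.erase j) P.coeff where
  gram := P.wordGram_cons
  coeff_self := P.coeff_cons_self
  remove_self := Word.erase_cons_self
  coeff_ne _ _ β hij := P.coeff_cons_ne hij β
  remove_ne _ _ β hij := Word.erase_cons_ne hij β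

end InfiniteWords

/-! ### Removing the letters of an infinite word: convergence of the coefficients -/

section Convergence

variable {d : ℕ} (P : QData d)

/-- There are finitely many letters, so the bounds `|q_ij| < 1` are uniform. The uniform `r` drives
all the decay estimates. -/
lemma QData.exists_norm_q_le : ∃ r : ℝ, 0 ≤ r ∧ r < 1 ∧ ∀ i j, i ≠ j → ‖P.q i j‖ ≤ r := by
  classical
  let f : Fin d × Fin d → NNReal := fun p => if p.1 ≠ p.2 then ‖P.q p.1 p.2‖₊ else 0
  refine ⟨(Finset.univ.sup f : NNReal), NNReal.coe_nonneg _, ?_, fun i j hij => ?_⟩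
  · have h : Finset.univ.sup f < 1 := by
      rw [Finset.sup_lt_iff (by simp)]
      rintro ⟨i, j⟩ -
      by_cases hij : i = j
      · simp [f, hij]
      · simp only [f, ne_eq, hij, not_false_eq_true, if_true]
        exact_mod_cast P.norm_q_lt_one i j hij
    exact_mod_cast h
  · have h := Finset.le_sup (f := f) (Finset.mem_univ (i, j))
    simp only [f, ne_eq, hij, not_false_eq_true, if_true] at h
    exact_mod_cast h

lemma QData.norm_qLetter_le_one (j : Fin d) (ν : List (Fin d)) : ‖P.qLetter j ν‖ ≤ 1 := by
  induction ν with
  | nil => simp [QData.qLetter]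
  | cons k ν ih =>
    rw [QData.qLetter]
    split_ifs with h
    · simp
    · rw [norm_mul]
      exact mul_le_one₀ (P.norm_q_lt_one j k (Ne.symm h)).le (norm_nonneg _) ih

lemma QData.norm_qWord_le_one (μ ν : List (Fin d)) : ‖P.qWord μ ν‖ ≤ 1 := by
  induction μ generalizing ν with
  | nil => simp [QData.qWord]
  | cons j μ ih =>
    rw [QData.qWord, norm_mul]
    exact mul_le_one₀ (P.norm_qLetter_le_one j ν) (norm_nonneg _) (ih _)

lemma QData.norm_qWord_append_le (μ μ' ν : List (Fin d)) :
    ‖P.qWord (μ ++ μ') ν‖ ≤ ‖P.qWord μ ν‖ := by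
  induction μ generalizing ν with
  | nil => simpa [QData.qWord] using P.norm_qWord_le_one μ' ν
  | cons j μ ih =>
    rw [List.cons_append, QData.qWord, QData.qWord, norm_mul, norm_mul]
    exact mul_le_mul_of_nonneg_left (ih _) (norm_nonneg _)

lemma QData.norm_qLetter_le_pow {r : ℝ} (hr : ∀ i j, i ≠ j → ‖P.q i j‖ ≤ r) {j : Fin d}
    {ν : List (Fin d)} (hj : j ∉ ν) : ‖P.qLetter j ν‖ ≤ r ^ ν.length := by
  induction ν with
  | nil => simp [QData.qLetter]
  | cons k ν ih =>
    rw [List.mem_cons, not_or] at hj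
    rw [QData.qLetter, if_neg (Ne.symm hj.1), norm_mul, List.length_cons, pow_succ']
    exact mul_le_mul (hr j k hj.1) (ih hj.2) (norm_nonneg _)
      ((norm_nonneg _).trans (hr j k hj.1))

lemma QData.norm_coeff_le_one (j : Fin d) (β : Word d) : ‖P.coeff j β‖ ≤ 1 := by
  by_cases h : β.Contains j
  · obtain ⟨k, hk⟩ := h
    rw [(P.coeff_eq_qLetter (m := k) (Word.mem_take.mpr ⟨k, k.lt_succ_self, hk⟩)).1]
    exact P.norm_qLetter_le_one _ _
  · simp [P.coeff_eq_zero h]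

/-- A letter that does not stand first has to be moved past `β 0`, which costs the factor `q j (β
0)`. -/
lemma QData.norm_coeff_le {r : ℝ} (hr : ∀ i j, i ≠ j → ‖P.q i j‖ ≤ r) {j : Fin d}
    {β : Word d} (h : j ≠ β 0) : ‖P.coeff j β‖ ≤ r := by
  obtain ⟨i, β, rfl⟩ := β.eq_cons
  have h : j ≠ i := h
  rw [P.coeff_cons_ne h, norm_mul]
  exact (mul_le_of_le_one_right (norm_nonneg _) (P.norm_coeff_le_one j β)).trans (hr j i h)

/-- This is the Cauchy–Schwarz inequality for unit vectors, in the Gram space of all infinite words.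
-/
lemma QData.norm_wordGram_le_one (γ β : Word d) : ‖P.wordGram γ β‖ ≤ 1 := by
  have h1 : ∀ β, ‖GramSpace.vec P.posSemidef_wordGram β‖ = 1 := fun β => by
    rw [norm_eq_sqrt_re_inner (𝕜 := ℂ), GramSpace.inner_vec, P.wordGram_self]
    simp
  have h := norm_inner_le_norm (𝕜 := ℂ) (GramSpace.vec P.posSemidef_wordGram γ)
    (GramSpace.vec P.posSemidef_wordGram β)
  rwa [GramSpace.inner_vec, h1, h1, one_mul] at h

/-- `β ∖ μ` for a finite word `μ`. -/
def Word.eraseList (μ : List (Fin d)) (β : Word d) : Word d :=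
  removeList (fun j β => Word.erase β j) μ β

/-- The coefficient of `s_μ^* e_β`. -/
def QData.coeffWord (μ : List (Fin d)) (β : Word d) : ℂ :=
  coeffList (fun j β => Word.erase β j) P.coeff μ β

lemma Word.eraseList_take_succ (γ β : Word d) (m : ℕ) :
    Word.eraseList (γ.take (m + 1)) β = (Word.eraseList (γ.take m) β).erase (γ m) := by
  rw [Word.take_succ]
  exact removeList_append _ _ _ _

lemma QData.coeffWord_take_succ (γ β : Word d) (m : ℕ) :
    P.coeffWord (γ.take (m + 1)) β =
      P.coeffWord (γ.take m) β * P.coeff (γ m) (Word.eraseList (γ.take m) β) := by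
  rw [Word.take_succ]
  refine (coeffList_append _ _ _ _ _).trans ?_
  simp [coeffList, QData.coeffWord, Word.eraseList]

lemma Word.insertList_take_drop (γ : Word d) (m : ℕ) :
    insertList Word.cons (γ.take m) (γ.drop m) = γ := by
  induction m generalizing γ with
  | zero => exact funext fun k => congrArg γ (zero_add k)
  | succ m ih =>
    obtain ⟨i, γ, rfl⟩ := γ.eq_cons
    rw [Word.take_cons, insertList]
    have h : (Word.cons i γ).drop (m + 1) = γ.drop m := by
      funext k
      change Word.cons i γ (m + 1 + k) = γ (m + k)
      rw [add_right_comm]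
      rfl
    rw [h, ih]

lemma Word.erase_head (β : Word d) : β.erase (β 0) = β.drop 1 := by
  conv_lhs => rw [← β.cons_drop_one]
  exact Word.erase_cons_self _ _

lemma Word.drop_drop (β : Word d) (m n : ℕ) : (β.drop m).drop n = β.drop (m + n) :=
  funext fun k => congrArg β (add_assoc m n k).symm

lemma Word.eraseList_take_eq_drop {γ β : Word d} {i : ℕ}
    (h : Word.eraseList (γ.take i) β = γ.drop i) {m : ℕ} (hm : i ≤ m) :
    Word.eraseList (γ.take m) β = γ.drop m := by
  induction m, hm using Nat.le_induction with
  | base => exact h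
  | succ m _ ih =>
    rw [Word.eraseList_take_succ, ih]
    have h1 : γ m = γ.drop m 0 := rfl
    rw [h1, Word.erase_head, Word.drop_drop]

/-- If the letters of `γ` are removed from `β` one after the other, either what is left of the two
words coincides after some step, or the coefficients tend to zero. -/
lemma QData.eraseList_eq_or_tendsto_zero (γ β : Word d) :
    (∃ i, Word.eraseList (γ.take i) β = γ.drop i) ∨
      Tendsto (fun m => P.coeffWord (γ.take m) β) atTop (𝓝 0) := by
  by_cases hev : ∃ N, ∀ m, N ≤ m → γ m = Word.eraseList (γ.take m) β 0
  · obtain ⟨N, hN⟩ := hev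
    -- From step `N` on every removal strikes out the head of the remaining word; hence the letters
    -- of `γ` from `N` on are exactly the letters of that remainder.
    refine Or.inl ⟨N, funext fun k => ?_⟩
    have h : ∀ k, Word.eraseList (γ.take (N + k)) β = (Word.eraseList (γ.take N) β).drop k := by
      intro k
      induction k with
      | zero => exact funext fun k => congrArg _ (zero_add k).symm
      | succ k ih =>
        rw [← add_assoc, Word.eraseList_take_succ, hN (N + k) (by omega), Word.erase_head, ih,
          Word.drop_drop]
    exact (congrFun (h k) 0).symm.trans (hN (N + k) (by omega)).symm
  · right
    push Not at hev
    obtain ⟨r, hr0, hr1, hr⟩ := P.exists_norm_q_le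
    have hanti : Antitone fun m => ‖P.coeffWord (γ.take m) β‖ := antitone_nat_of_succ_le fun m => by
      rw [P.coeffWord_take_succ, norm_mul]
      exact mul_le_of_le_one_right (norm_nonneg _) (P.norm_coeff_le_one _ _)
    have hbdd : BddBelow (Set.range fun m => ‖P.coeffWord (γ.take m) β‖) :=
      ⟨0, by rintro _ ⟨m, rfl⟩; exact norm_nonneg _⟩
    have hlim := tendsto_atTop_ciInf hanti hbdd
    set l := ⨅ m, ‖P.coeffWord (γ.take m) β‖ with hl
    have hl0 : 0 ≤ l := le_ciInf fun m => norm_nonneg _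
    -- The norms decrease to `l`, and infinitely often one step multiplies them by at most `r`.
    -- Since `r < 1` and `0 ≤ l`, this forces `l = 0`.
    have hle : l ≤ r * l := by
      refine ge_of_tendsto_of_frequently (hlim.const_mul r) (frequently_atTop.mpr fun N => ?_)
      obtain ⟨m, hm, hne⟩ := hev N
      refine ⟨m, hm, (ciInf_le hbdd (m + 1)).trans ?_⟩
      rw [P.coeffWord_take_succ, norm_mul, mul_comm]
      exact mul_le_mul_of_nonneg_right (P.norm_coeff_le hr hne) (norm_nonneg _)
    have hzero : l = 0 := by nlinarith
    rw [hzero] at hlim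
    exact tendsto_zero_iff_norm_tendsto_zero.mpr hlim

lemma QData.wordGram_eq_coeffWord_mul (γ β : Word d) (m : ℕ) :
    P.wordGram γ β = P.coeffWord (γ.take m) β *
      P.wordGram (γ.drop m) (Word.eraseList (γ.take m) β) := by
  conv_lhs => rw [← γ.insertList_take_drop m]
  exact (isGramSystem_word P).gram_insertList _ _ _

lemma QData.wordGram_eq_coeffWord {γ β : Word d} {m : ℕ}
    (h : Word.eraseList (γ.take m) β = γ.drop m) :
    P.wordGram γ β = P.coeffWord (γ.take m) β := by
  rw [P.wordGram_eq_coeffWord_mul γ β m, h, P.wordGram_self, mul_one]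

lemma QData.wordGram_eq_zero_of_tendsto {γ β : Word d}
    (h : Tendsto (fun m => P.coeffWord (γ.take m) β) atTop (𝓝 0)) : P.wordGram γ β = 0 := by
  refine tendsto_nhds_unique tendsto_const_nhds
    (squeeze_zero_norm (fun m => ?_) (by simpa using h.norm))
  rw [P.wordGram_eq_coeffWord_mul γ β m, norm_mul]
  exact mul_le_of_le_one_right (norm_nonneg _) (P.norm_wordGram_le_one _ _)

lemma Word.length_take (β : Word d) (m : ℕ) : (β.take m).length = m := by simp [Word.take]

/-- For a fixed letter found in `β`, the coefficient of a long initial segment is already that of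
`β`. For a letter missing from `β`, the coefficient of a segment of length `m` is at most `r ^ m`,
in accordance with the value `0` of `QData.coeff`. -/
lemma QData.tendsto_qWord_take (μ : List (Fin d)) (β : Word d) :
    Tendsto (fun m => P.qWord μ (β.take m)) atTop (𝓝 (P.coeffWord μ β)) := by
  induction μ generalizing β with
  | nil => exact tendsto_const_nhds
  | cons j μ ih =>
    have hc : P.coeffWord (j :: μ) β = P.coeff j β * P.coeffWord μ (β.erase j) := rfl
    rw [hc]
    by_cases h : β.Contains j
    · obtain ⟨l, hl⟩ := h
      rw [← tendsto_add_atTop_iff_nat 1]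
      refine ((ih (β.erase j)).const_mul (P.coeff j β)).congr' ?_
      filter_upwards [eventually_ge_atTop l] with m hm
      have hmem : j ∈ β.take (m + 1) := Word.mem_take.mpr ⟨l, by omega, hl⟩
      obtain ⟨h1, h2⟩ := P.coeff_eq_qLetter hmem
      rw [QData.qWord, h1, h2]
    · have hnot : ∀ m, j ∉ β.take m := fun m hm => by
        obtain ⟨k, _, hk⟩ := Word.mem_take.mp hm
        exact h ⟨k, hk⟩
      obtain ⟨r, hr0, hr1, hr⟩ := P.exists_norm_q_le
      rw [P.coeff_eq_zero h, zero_mul]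
      refine squeeze_zero_norm (fun m => ?_) (tendsto_pow_atTop_nhds_zero_of_lt_one hr0 hr1)
      rw [QData.qWord, norm_mul]
      refine (mul_le_of_le_one_right (norm_nonneg _) (P.norm_qWord_le_one _ _)).trans ?_
      exact (P.norm_qLetter_le_pow hr (hnot m)).trans_eq (by rw [Word.length_take])

/-- Since the coefficient is nonzero, every letter of `μ` is really found in what is left of `β`.
Each removal then shortens the initial segment by exactly one letter, so that length `m + μ.length`
becomes length `m`. -/
lemma QData.eventually_qWord_append {μ : List (Fin d)} {β : Word d} (h : P.coeffWord μ β ≠ 0) :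
    ∀ᶠ m in atTop, ∀ μ' : List (Fin d), P.qWord (μ ++ μ') (β.take (m + μ.length)) =
      P.coeffWord μ β * P.qWord μ' ((Word.eraseList μ β).take m) := by
  induction μ generalizing β with
  | nil => exact Eventually.of_forall fun m μ' => (one_mul _).symm
  | cons j μ ih =>
    have hc : P.coeffWord (j :: μ) β = P.coeff j β * P.coeffWord μ (β.erase j) := rfl
    rw [hc] at h ⊢
    have hj : β.Contains j := by
      by_contra hj
      rw [P.coeff_eq_zero hj, zero_mul] at h
      exact h rfl
    obtain ⟨l, hl⟩ := hj
    filter_upwards [ih (right_ne_zero_of_mul h), eventually_ge_atTop l] with m hm hlm μ'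
    have hmem : j ∈ β.take (m + μ.length + 1) := Word.mem_take.mpr ⟨l, by omega, hl⟩
    obtain ⟨h1, h2⟩ := P.coeff_eq_qLetter hmem
    rw [List.cons_append, List.length_cons, ← add_assoc, QData.qWord, h2, hm, h1, mul_assoc]
    rfl

lemma QData.qWord_self (μ : List (Fin d)) : P.qWord μ μ = 1 := by
  induction μ with
  | nil => rfl
  | cons j μ ih => simp [QData.qWord, QData.qLetter, ih]

lemma Word.take_add (γ : Word d) (m n : ℕ) : γ.take (m + n) = γ.take m ++ (γ.drop m).take n := by
  simp only [Word.take, List.range_add, List.map_append, List.map_map]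
  rfl

/-- The scalar product of `e_γ` and `e_β` is the limit of the coefficients `q(γ, β)` of the initial
segments. -/
lemma QData.tendsto_qWord_take_take (γ β : Word d) :
    Tendsto (fun m => P.qWord (γ.take m) (β.take m)) atTop (𝓝 (P.wordGram γ β)) := by
  by_cases h0 : Tendsto (fun m => P.coeffWord (γ.take m) β) atTop (𝓝 0)
  · rw [P.wordGram_eq_zero_of_tendsto h0, Metric.tendsto_atTop']
    intro ε hε
    -- Fix `i` with `‖P.coeffWord (γ.take i) β‖ < ε`. With the first word fixed, long segments of
    -- `β` give values below `ε`, and lengthening the first word does not increase the norm.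
    obtain ⟨i, hi⟩ := (Metric.tendsto_atTop.mp h0 ε hε)
    have h1 : ∀ᶠ m in atTop, ‖P.qWord (γ.take i) (β.take m)‖ < ε := by
      refine (P.tendsto_qWord_take (γ.take i) β).norm.eventually_lt_const ?_
      simpa using hi i le_rfl
    obtain ⟨N, hN⟩ := eventually_atTop.mp h1
    refine ⟨N + i, fun m hm => ?_⟩
    obtain ⟨n, rfl⟩ : ∃ n, m = i + n := ⟨m - i, by omega⟩
    rw [dist_zero_right, Word.take_add γ i n]
    exact (P.norm_qWord_append_le _ _ _).trans_lt (hN _ (by omega))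
  · obtain ⟨i, hi⟩ := (P.eraseList_eq_or_tendsto_zero γ β).resolve_right h0
    -- A zero coefficient stays zero after further removals, which would contradict `h0`.
    have hne : P.coeffWord (γ.take i) β ≠ 0 := by
      intro hz
      refine h0 (tendsto_const_nhds.congr' ?_)
      filter_upwards [eventually_ge_atTop i] with m hm
      obtain ⟨n, rfl⟩ : ∃ n, m = i + n := ⟨m - i, by omega⟩
      rw [Word.take_add]
      refine Eq.symm ((coeffList_append _ _ _ _ _).trans ?_)
      exact mul_eq_zero_of_left hz _
    refine tendsto_const_nhds.congr' ?_
    rw [← map_add_atTop_eq_nat i, EventuallyEq, eventually_map]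
    filter_upwards [P.eventually_qWord_append hne] with m hm
    rw [Word.length_take] at hm
    -- After `i` removals both words have the same rest, whose initial segments contribute `q(μ, μ)
    -- = 1`; the sequence is eventually constant.
    rw [P.wordGram_eq_coeffWord hi, add_comm m i, Word.take_add γ, add_comm i m, hm, hi,
      P.qWord_self, mul_one]

end Convergence

/-! ### The representations `π_α`: irreducibility and equivalence -/

section WordRepresentations

variable {d : ℕ} {P : QData d} {α : Word d}

lemma TailEquiv.refl (α : Word d) : TailEquiv α α := ⟨0, 0, fun _ => rfl⟩

lemma TailEquiv.symm {α β : Word d} (h : TailEquiv α β) : TailEquiv β α := by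
  obtain ⟨m, n, h⟩ := h
  exact ⟨n, m, fun k => (h k).symm⟩

lemma TailEquiv.trans {α β γ : Word d} (h : TailEquiv α β) (h' : TailEquiv β γ) :
    TailEquiv α γ := by
  obtain ⟨m, n, h⟩ := h
  obtain ⟨m', n', h'⟩ := h'
  refine ⟨m + m', n' + n, fun k => ?_⟩
  rw [add_assoc, h, add_assoc, ← h', ← add_assoc, ← add_assoc, add_comm n]

lemma TailEquiv.drop (α : Word d) (m : ℕ) : TailEquiv (α.drop m) α :=
  ⟨0, m, fun k => by rw [zero_add]; rfl⟩

/-- `σ_j` on an equivalence class of words. -/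
def TailClass.cons (j : Fin d) (β : TailClass α) : TailClass α := ⟨Word.cons j β.1, β.2.cons j⟩

/-- `β ∖ j` on an equivalence class of words. -/
def TailClass.erase (j : Fin d) (β : TailClass α) : TailClass α := ⟨β.1.erase j, β.2.erase j⟩

variable (P) in
lemma isGramSystem_class (α : Word d) :
    IsGramSystem P (P.wordGram.submatrix (fun β : TailClass α => β.1) fun β => β.1)
      TailClass.cons TailClass.erase fun j β => P.coeff j β.1 where
  gram j γ β := P.wordGram_cons j γ.1 β.1
  coeff_self j β := P.coeff_cons_self j β.1
  remove_self j β := Subtype.ext (Word.erase_cons_self j β.1)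
  coeff_ne _ _ β hij := P.coeff_cons_ne hij β.1
  remove_ne _ _ β hij := Subtype.ext (Word.erase_cons_ne hij β.1)

/-- The case distinction for `s_j^*` is absorbed in a coefficient that vanishes when `j` does not
occur, which gives access to the general results on Gram systems. -/
lemma isWordRep_iff {π : W P →⋆ₐ[ℂ] (HSpace P α →L[ℂ] HSpace P α)} :
    IsWordRep P α π ↔ IsGramRep (posSemidef_classGram P α) TailClass.cons TailClass.erase
      (fun j β => P.coeff j β.1) π := by
  classical
  refine forall_congr' fun j => forall_congr' fun β => and_congr Iff.rfl ?_
  refine Eq.congr_right ?_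
  by_cases h : β.1.Contains j
  · simp only [QData.coeff, if_pos h]; rfl
  · simp only [QData.coeff, if_neg h, zero_smul]

lemma isFockRep_iff {π : W P →⋆ₐ[ℂ] (FockSpace P →L[ℂ] FockSpace P)} :
    IsFockRep P π ↔ IsGramRep P.posSemidef_fockGram List.cons (fun j μ => μ.erase j)
      P.fockCoeff π := by
  refine forall_congr' fun j => forall_congr' fun μ => and_congr Iff.rfl ?_
  refine Eq.congr_right ?_
  by_cases h : j ∈ μ
  · simp only [QData.fockCoeff, if_pos h]; rfl
  · simp only [QData.fockCoeff, if_neg h, zero_smul]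

lemma TailClass.removeList_val (μ : List (Fin d)) (β : TailClass α) :
    (removeList TailClass.erase μ β).1 = Word.eraseList μ β.1 := by
  induction μ generalizing β with
  | nil => rfl
  | cons j μ ih => exact ih _

lemma TailClass.insertList_val (μ : List (Fin d)) (β : TailClass α) :
    (insertList TailClass.cons μ β).1 = insertList Word.cons μ β.1 := by
  induction μ with
  | nil => rfl
  | cons j μ ih => exact congrArg (Word.cons j) ih

lemma TailClass.coeffList_eq (μ : List (Fin d)) (β : TailClass α) :
    coeffList TailClass.erase (fun j (β : TailClass α) => P.coeff j β.1) μ β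
      = P.coeffWord μ β.1 := by
  induction μ generalizing β with
  | nil => rfl
  | cons j μ ih => exact congrArg (P.coeff j β.1 * ·) (ih _)

lemma HSpace.inner_vec (γ β : TailClass α) :
    inner ℂ (HSpace.vec P γ) (HSpace.vec P β) = P.wordGram γ.1 β.1 :=
  GramSpace.inner_vec _ _ _

lemma HSpace.norm_vec (β : TailClass α) : ‖HSpace.vec P β‖ = 1 := by
  rw [norm_eq_sqrt_re_inner (𝕜 := ℂ), HSpace.inner_vec, P.wordGram_self]
  simp

variable {π : W P →⋆ₐ[ℂ] (HSpace P α →L[ℂ] HSpace P α)}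

/-- Once the rests coincide, `s_μ^*` sends `e_β` to a multiple of the vector of the rest of `γ`, and
`s_μ` rebuilds `γ` from it; the multiple is the scalar product. -/
lemma IsWordRep.rangeProj_vec (hπ : IsWordRep P α π) {γ β : TailClass α} {m : ℕ}
    (h : Word.eraseList (γ.1.take m) β.1 = γ.1.drop m) :
    π (W.rangeProj P (γ.1.take m)) (HSpace.vec P β) = P.wordGram γ.1 β.1 • HSpace.vec P γ := by
  refine ((isWordRep_iff.mp hπ).rangeProj_vec _ _).trans ?_
  rw [TailClass.coeffList_eq, P.wordGram_eq_coeffWord h]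
  congr 2
  refine Subtype.ext ?_
  rw [TailClass.insertList_val, TailClass.removeList_val, h, Word.insertList_take_drop]

lemma IsWordRep.rangeProj_vec_self (hπ : IsWordRep P α π) (γ : TailClass α) (m : ℕ) :
    π (W.rangeProj P (γ.1.take m)) (HSpace.vec P γ) = HSpace.vec P γ := by
  have h : Word.eraseList (γ.1.take 0) γ.1 = γ.1.drop 0 :=
    funext fun k => congrArg γ.1 (zero_add k).symm
  rw [hπ.rangeProj_vec (Word.eraseList_take_eq_drop h m.zero_le), P.wordGram_self, one_smul]

/-- The range projections of the initial segments of `γ` converge strongly to the projection onto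
the line spanned by `e_γ`. -/
lemma IsWordRep.tendsto_rangeProj (hπ : IsWordRep P α π) (γ : TailClass α) (v : HSpace P α) :
    Tendsto (fun m => π (W.rangeProj P (γ.1.take m)) v) atTop
      (𝓝 (inner ℂ (HSpace.vec P γ) v • HSpace.vec P γ)) := by
  refine GramSpace.tendsto_of_vec (posSemidef_classGram P α)
    (L := (innerSL ℂ (HSpace.vec P γ)).smulRight (HSpace.vec P γ))
    (T := fun m => π (W.rangeProj P (γ.1.take m))) (fun m =>
      (NonUnitalStarAlgHom.norm_apply_le π _).trans (W.norm_rangeProj_le _)) (fun β => ?_) v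
  have hL : (innerSL ℂ (HSpace.vec P γ)).smulRight (HSpace.vec P γ) (HSpace.vec P β)
      = P.wordGram γ.1 β.1 • HSpace.vec P γ := by
    rw [ContinuousLinearMap.smulRight_apply, innerSL_apply_apply, HSpace.inner_vec]
  refine Tendsto.congr' ?_ (hL ▸ ?_ : Tendsto (fun m => π (W.rangeProj P (γ.1.take m))
    (HSpace.vec P β)) atTop (𝓝 _))
  · exact EventuallyEq.rfl
  · rcases P.eraseList_eq_or_tendsto_zero γ.1 β.1 with ⟨i, hi⟩ | h0
    · refine tendsto_const_nhds.congr' ?_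
      filter_upwards [eventually_ge_atTop i] with m hm
      exact (hπ.rangeProj_vec (Word.eraseList_take_eq_drop hi hm)).symm
    · rw [P.wordGram_eq_zero_of_tendsto h0, zero_smul]
      refine squeeze_zero_norm (fun m => ?_) (by simpa using h0.norm)
      refine (congrArg _ ((isWordRep_iff.mp hπ).rangeProj_vec _ _)).trans_le ?_
      rw [norm_smul, TailClass.coeffList_eq]
      exact mul_le_of_le_one_right (norm_nonneg _) (HSpace.norm_vec _).le

lemma IsWordRep.sWord_vec (hπ : IsWordRep P α π) (μ : List (Fin d)) (β : TailClass α) :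
    π (W.sWord P μ) (HSpace.vec P β) = HSpace.vec P (insertList TailClass.cons μ β) :=
  (isWordRep_iff.mp hπ).sWord_vec μ β

/-- The vector `e_γ` is the image under `s_μ` of the vector of its rest, and inserting then removing
`μ` gives the rest back with coefficient `1`. -/
lemma IsWordRep.star_sWord_vec (hπ : IsWordRep P α π) (γ : TailClass α) (m : ℕ) :
    π (star (W.sWord P (γ.1.take m))) (HSpace.vec P γ) =
      HSpace.vec P ⟨γ.1.drop m, (TailEquiv.drop γ.1 m).trans γ.2⟩ := by
  have h : γ = insertList TailClass.cons (γ.1.take m)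
      ⟨γ.1.drop m, (TailEquiv.drop γ.1 m).trans γ.2⟩ :=
    Subtype.ext (by rw [TailClass.insertList_val, Word.insertList_take_drop])
  refine ((isWordRep_iff.mp hπ).star_sWord_vec _ _).trans ?_
  have h1 := (isGramSystem_class P α).coeffList_insertList (γ.1.take m)
    ⟨γ.1.drop m, (TailEquiv.drop γ.1 m).trans γ.2⟩
  have h2 := (isGramSystem_class P α).removeList_insertList (γ.1.take m)
    ⟨γ.1.drop m, (TailEquiv.drop γ.1 m).trans γ.2⟩
  rw [← h] at h1 h2
  rw [h1, h2, one_smul]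
  rfl

theorem IsWordRep.isIrreducible (hπ : IsWordRep P α π) : IsIrreducible π := by
  refine ⟨⟨HSpace.vec P ⟨α, TailEquiv.refl α⟩, 0, fun h => ?_⟩, fun K hK hinv => ?_⟩
  · have h1 := HSpace.norm_vec (P := P) (⟨α, TailEquiv.refl α⟩ : TailClass α)
    rw [h, norm_zero] at h1
    exact zero_ne_one h1
  by_cases hex : ∃ v ∈ K, ∃ γ : TailClass α, inner ℂ (HSpace.vec P γ) v ≠ 0
  · obtain ⟨v, hv, γ, hγ⟩ := hex
    -- The range projections applied to `v` stay in the closed subspace `K` and converge to a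
    -- nonzero multiple of `e_γ`.
    have hmem : HSpace.vec P γ ∈ K := by
      have h := hK.mem_of_tendsto (hπ.tendsto_rangeProj γ v)
        (Eventually.of_forall fun m => hinv _ _ hv)
      exact (K.smul_mem_iff hγ).mp h
    refine Or.inr (GramSpace.eq_top_of_vec_mem _ K hK fun β => ?_)
    -- The rest of `β` after `m` letters is that of `γ` after `n` letters: strip `n` letters from
    -- `γ` by an adjoint, then prepend the first `m` letters of `β`.
    obtain ⟨m, n, h⟩ := β.2.trans γ.2.symm
    have h1 : β = insertList TailClass.cons (β.1.take m)
        ⟨γ.1.drop n, (TailEquiv.drop γ.1 n).trans γ.2⟩ := by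
      refine Subtype.ext ?_
      have h2 : γ.1.drop n = β.1.drop m := funext fun k => (h k).symm
      rw [TailClass.insertList_val]
      exact ((congrArg _ h2).trans (Word.insertList_take_drop _ _)).symm
    have h3 := hinv (W.sWord P (β.1.take m)) _ (hinv (star (W.sWord P (γ.1.take n))) _ hmem)
    rw [hπ.star_sWord_vec, hπ.sWord_vec, ← h1] at h3
    exact h3
  · push Not at hex
    -- Here every vector of `K` is orthogonal to all `e_γ`, hence zero.
    refine Or.inl ((Submodule.eq_bot_iff K).mpr fun v hv => ?_)
    refine GramSpace.ext_inner_vec fun γ => ?_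
    rw [inner_zero_right]
    exact hex v hv γ

/-- A representation in which the range projections of the initial segments of `α` tend to zero
strongly is not equivalent to `π_α`. -/
lemma IsWordRep.not_unitarilyEquivalent (hπ : IsWordRep P α π) {K : Type} [NormedAddCommGroup K]
    [InnerProductSpace ℂ K] [CompleteSpace K] {ρ : W P →⋆ₐ[ℂ] (K →L[ℂ] K)}
    (h : ∀ v, Tendsto (fun m => ρ (W.rangeProj P (α.take m)) v) atTop (𝓝 0)) :
    ¬ UnitarilyEquivalent π ρ := by
  rintro ⟨U, hU⟩
  -- All these projections fix the unit vector `e_α`, so they would fix its image under a unitary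
  -- equivalence, although they tend to zero there.
  have hfix : ∀ m, ρ (W.rangeProj P (α.take m)) (U (HSpace.vec P ⟨α, TailEquiv.refl α⟩))
      = U (HSpace.vec P ⟨α, TailEquiv.refl α⟩) := fun m => by
    rw [← hU, hπ.rangeProj_vec_self ⟨α, TailEquiv.refl α⟩ m]
  have h0 := h (U (HSpace.vec P ⟨α, TailEquiv.refl α⟩))
  simp only [hfix] at h0
  have h1 := tendsto_nhds_unique h0 tendsto_const_nhds
  have h2 := HSpace.norm_vec (P := P) (⟨α, TailEquiv.refl α⟩ : TailClass α)
  rw [← U.norm_map, ← h1, norm_zero] at h2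
  exact zero_ne_one h2

/-- If the rests of `γ` and of some `β ∼ α` coincided, `γ` would be equivalent to `α`. So for each
`e_β` only the second alternative of the dichotomy remains. -/
lemma IsWordRep.tendsto_rangeProj_zero (hπ : IsWordRep P α π) {γ : Word d}
    (h : ¬ TailEquiv γ α) (v : HSpace P α) :
    Tendsto (fun m => π (W.rangeProj P (γ.take m)) v) atTop (𝓝 0) := by
  refine (isWordRep_iff.mp hπ).tendsto_rangeProj_zero _ (fun β => (HSpace.norm_vec β).le)
    (fun β => ?_) v
  simp only [TailClass.coeffList_eq]
  refine (P.eraseList_eq_or_tendsto_zero γ β.1).resolve_left ?_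
  rintro ⟨i, hi⟩
  rw [← TailClass.removeList_val] at hi
  exact h ((TailEquiv.drop γ i).symm.trans (hi ▸ (removeList TailClass.erase (γ.take i) β).2))

lemma FockSpace.norm_vec_le (μ : List (Fin d)) :
    ‖GramSpace.vec P.posSemidef_fockGram μ‖ ≤ 1 := by
  rw [norm_eq_sqrt_re_inner (𝕜 := ℂ), GramSpace.inner_vec]
  simp [QData.fockGram, P.qWord_self]

lemma IsFockRep.tendsto_rangeProj_zero {π : W P →⋆ₐ[ℂ] (FockSpace P →L[ℂ] FockSpace P)}
    (hπ : IsFockRep P π) (γ : Word d) (v : FockSpace P) :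
    Tendsto (fun m => π (W.rangeProj P (γ.take m)) v) atTop (𝓝 0) := by
  refine (isFockRep_iff.mp hπ).tendsto_rangeProj_zero _ FockSpace.norm_vec_le (fun ν => ?_) v
  refine tendsto_const_nhds.congr' ?_
  filter_upwards [eventually_gt_atTop ν.length] with m hm
  exact (coeffList_fock_eq_zero P _ _ (by rwa [Word.length_take])).symm

/-- For `α ∼ α'` the two classes are equal as sets of words, but the spaces are different types.
Stating this for arbitrary predicates allows the equality to be substituted. -/
lemma exists_wordSpace_isometryEquiv (P : QData d) {p p' : Word d → Prop} (h : p = p') :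
    ∃ U : GramSpace (P.posSemidef_wordGram.submatrix fun β : {β // p β} => β.1) ≃ₗᵢ[ℂ]
        GramSpace (P.posSemidef_wordGram.submatrix fun β : {β // p' β} => β.1),
      ∀ β hβ, U (GramSpace.vec _ ⟨β, hβ⟩) = GramSpace.vec _ ⟨β, h ▸ hβ⟩ := by
  subst h
  exact ⟨LinearIsometryEquiv.refl ℂ _, fun _ _ => rfl⟩

/-- A representation can be transported along a unitary map. -/
lemma exists_conj_starAlgHom {A H K : Type} [CStarAlgebra A]
    [NormedAddCommGroup H] [InnerProductSpace ℂ H] [CompleteSpace H]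
    [NormedAddCommGroup K] [InnerProductSpace ℂ K] [CompleteSpace K]
    (π : A →⋆ₐ[ℂ] (H →L[ℂ] H)) (U : H ≃ₗᵢ[ℂ] K) :
    ∃ ρ : A →⋆ₐ[ℂ] (K →L[ℂ] K), ∀ a x, ρ a x = U (π a (U.symm x)) :=
  ⟨(StarAlgHomClass.toStarAlgHom U.conjStarAlgEquiv).comp π, fun _ _ => rfl⟩

lemma IsWordRep.unitarilyEquivalent {α' : Word d}
    {π' : W P →⋆ₐ[ℂ] (HSpace P α' →L[ℂ] HSpace P α')} (hπ : IsWordRep P α π)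
    (hπ' : IsWordRep P α' π') (h : TailEquiv α α') : UnitarilyEquivalent π π' := by
  have hp : (fun β => TailEquiv β α) = fun β => TailEquiv β α' :=
    funext fun β => propext ⟨fun hβ => hβ.trans h, fun hβ => hβ.trans h.symm⟩
  obtain ⟨U, hU⟩ : ∃ U : HSpace P α ≃ₗᵢ[ℂ] HSpace P α', ∀ β hβ,
      U (HSpace.vec P ⟨β, hβ⟩) = HSpace.vec P ⟨β, hβ.trans h⟩ :=
    exists_wordSpace_isometryEquiv P hp
  have hrep : ∀ j x, U (π (W.s j) x) = π' (W.s j) (U x) := fun j x => by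
    have h1 : (U.toContinuousLinearEquiv : HSpace P α →L[ℂ] HSpace P α') ∘L π (W.s j)
        = π' (W.s j) ∘L (U.toContinuousLinearEquiv : HSpace P α →L[ℂ] HSpace P α') := by
      refine GramSpace.clm_ext fun β => ?_
      change U (π (W.s j) (HSpace.vec P β)) = π' (W.s j) (U (HSpace.vec P β))
      rw [(hπ j β).1, hU, hU β.1 β.2, (hπ' j _).1]
    exact congrArg (fun T => T x) h1
  obtain ⟨ρ, hρ⟩ := exists_conj_starAlgHom π U
  -- The conjugate of `π` by `U` agrees with `π'` on the generators, which determine a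
  -- `*`-homomorphism on `W`.
  have h2 : ρ = π' := W.starAlgHom_ext fun j => by
    ext1 x
    rw [hρ, hrep, U.apply_symm_apply]
  refine ⟨U, fun a x => ?_⟩
  rw [← h2, hρ, U.symm_apply_apply]

end WordRepresentations

/-! ### The case of vanishing coefficients -/

section CuntzRelations

variable {d : ℕ} {P : QData d}

lemma QData.coeff_eq_zero_of_ne (hq : ∀ i j, i ≠ j → P.q i j = 0) {j : Fin d} {β : Word d}
    (h : j ≠ β 0) : P.coeff j β = 0 := by
  obtain ⟨i, β, rfl⟩ := β.eq_cons
  have h : j ≠ i := h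
  rw [P.coeff_cons_ne h, hq j i h, zero_mul]

/-- Equal heads can be stripped from both words, while different heads give the coefficient zero. -/
lemma QData.wordGram_eq_zero_of_ne (hq : ∀ i j, i ≠ j → P.q i j = 0) {γ β : Word d} {n : ℕ}
    (h : γ n ≠ β n) : P.wordGram γ β = 0 := by
  induction n generalizing γ β with
  | zero =>
    rw [← γ.cons_drop_one, P.wordGram_cons, QData.coeff_eq_zero_of_ne hq h, zero_mul]
  | succ n ih =>
    obtain ⟨i, γ, rfl⟩ := γ.eq_cons
    obtain ⟨j, β, rfl⟩ := β.eq_cons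
    rw [P.wordGram_cons]
    by_cases hij : i = j
    · subst hij
      rw [Word.erase_cons_self, ih h, mul_zero]
    · rw [QData.coeff_eq_zero_of_ne hq hij, zero_mul]

lemma HSpace.orthonormal_vec (hq : ∀ i j, i ≠ j → P.q i j = 0) (α : Word d) :
    Orthonormal ℂ (HSpace.vec P (α := α)) := by
  classical
  refine orthonormal_iff_ite.mpr fun γ β => ?_
  rw [HSpace.inner_vec]
  by_cases h : γ = β
  · rw [if_pos h, h, P.wordGram_self]
  · rw [if_neg h]
    obtain ⟨n, hn⟩ := Function.ne_iff.mp fun h' => h (Subtype.ext h')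
    exact QData.wordGram_eq_zero_of_ne hq hn

lemma W.star_s_mul_s (hq : ∀ i j, i ≠ j → P.q i j = 0) (i j : Fin d) :
    star (W.s i : W P) * W.s j = if i = j then 1 else 0 := by
  split_ifs with h
  · subst h
    exact W.satisfiesRelations.isometry i
  · rw [W.satisfiesRelations.commutation i j h, hq i j h, zero_smul]

lemma IsWordRep.sum_s_mul_star_s (hq : ∀ i j, i ≠ j → P.q i j = 0) {α : Word d}
    {π : W P →⋆ₐ[ℂ] (HSpace P α →L[ℂ] HSpace P α)} (hπ : IsWordRep P α π) :
    ∑ j, π (W.s j * star (W.s j)) = 1 := by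
  refine GramSpace.clm_ext fun β => ?_
  have h : ∀ j, π (W.s j * star (W.s j)) (GramSpace.vec _ β) =
      P.coeff j β.1 • GramSpace.vec _ (TailClass.cons j (TailClass.erase j β)) := fun j => by
    rw [map_mul, mul_apply_eq_comp, ((isWordRep_iff.mp hπ) _ _).2, map_smul,
      ((isWordRep_iff.mp hπ) _ _).1]
  -- Only the first letter of `β` can be removed with nonzero coefficient, and reinserting it
  -- restores `β`.
  rw [sum_apply, Finset.sum_eq_single (β.1 0)]
  · rw [h]
    have hβ : TailClass.cons (β.1 0) (TailClass.erase (β.1 0) β) = β := by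
      refine Subtype.ext ?_
      change Word.cons (β.1 0) (β.1.erase (β.1 0)) = β.1
      rw [Word.erase_head, Word.cons_drop_one]
    have hc : P.coeff (β.1 0) β.1 = 1 := by
      conv_lhs => rw [← β.1.cons_drop_one]
      exact P.coeff_cons_self _ _
    rw [hβ, hc, one_smul]
    rfl
  · intro j _ hj
    rw [h, QData.coeff_eq_zero_of_ne hq hj, zero_smul]
  · exact fun hn => absurd (Finset.mem_univ _) hn

end CuntzRelations

/-! ### Infinitely many inequivalent words -/

section PeriodicWords

variable {d : ℕ}

/-- The word with the letter `b` at the multiples of `n + 1` and the letter `a` elsewhere. -/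
def periodicWord (a b : Fin d) (n : ℕ) : Word d := fun k => if (n + 1) ∣ k then b else a

lemma dvd_of_tailEquiv_periodicWord {a b : Fin d} (hab : a ≠ b) {n m : ℕ}
    (h : TailEquiv (periodicWord a b n) (periodicWord a b m)) : m + 1 ∣ n + 1 := by
  obtain ⟨s, t, h⟩ := h
  -- The places of `b` in the first tail are places of `b` in the second. Two of them at distance `n
  -- + 1` show that `m + 1` divides `n + 1`; the first is taken at `k = n * s`, where `s + k = (n +
  -- 1) * s`.
  have key : ∀ k, n + 1 ∣ s + k → m + 1 ∣ t + k := fun k hk => by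
    by_contra hk'
    have h1 := h k
    simp only [periodicWord, if_pos hk, if_neg hk'] at h1
    exact hab h1.symm
  have h1 : m + 1 ∣ t + n * s := key _ ⟨s, by ring⟩
  have h2 : m + 1 ∣ t + n * s + (n + 1) := by
    rw [add_assoc]
    exact key _ ⟨s + 1, by ring⟩
  exact (Nat.dvd_add_right h1).mp h2

lemma eq_of_tailEquiv_periodicWord {a b : Fin d} (hab : a ≠ b) {n m : ℕ}
    (h : TailEquiv (periodicWord a b n) (periodicWord a b m)) : n = m :=
  Nat.succ_injective (Nat.dvd_antisymm (dvd_of_tailEquiv_periodicWord hab h.symm)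
    (dvd_of_tailEquiv_periodicWord hab h))

/-- If there are two letters, there are infinitely many inequivalent words. -/
lemma exists_infinite_pairwise_not_tailEquiv (hd : 2 ≤ d) :
    ∃ S : Set (Word d), S.Infinite ∧ ∀ α ∈ S, ∀ α' ∈ S, α ≠ α' → ¬ TailEquiv α α' := by
  have hab : (⟨0, by omega⟩ : Fin d) ≠ ⟨1, by omega⟩ := by simp
  refine ⟨Set.range (periodicWord ⟨0, by omega⟩ ⟨1, by omega⟩),
    Set.infinite_range_of_injective fun n m h => eq_of_tailEquiv_periodicWord hab ?_, ?_⟩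
  · exact h ▸ TailEquiv.refl _
  · rintro _ ⟨n, rfl⟩ _ ⟨m, rfl⟩ hne h
    exact hne (congrArg _ (eq_of_tailEquiv_periodicWord hab h))

end PeriodicWords

end QIsom

end

/-! ### The main theorem -/

open QIsom in
theorem mainTheorem1 (d : ℕ) (P : QData d) :
    -- the scalar product of `e_γ` and `e_β` is the limit `q(γ, β)`
    (∀ (α : Word d) (β γ : TailClass α),
      Filter.Tendsto (fun m => P.qWord (γ.1.take m) (β.1.take m)) Filter.atTop
        (nhds (inner ℂ (HSpace.vec P γ) (HSpace.vec P β)))) ∧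
    -- existence and uniqueness of the Fock representation
    (∃! πF, IsFockRep P πF) ∧
    -- 1. `π_α` is a well-defined `*`-representation
    (∀ α : Word d, ∃! π, IsWordRep P α π) ∧
    -- 2. `π_α` is irreducible
    (∀ (α : Word d) π, IsWordRep P α π → IsIrreducible π) ∧
    -- 3. `π_α` and `π_α'` are unitarily equivalent if and only if `α ∼ α'`
    (∀ (α α' : Word d) π π', IsWordRep P α π → IsWordRep P α' π' →
      (UnitarilyEquivalent π π' ↔ TailEquiv α α')) ∧
    -- 4. `π_α` is not unitarily equivalent to the Fock representation
    (∀ (α : Word d) π πF, IsWordRep P α π → IsFockRep P πF → ¬ UnitarilyEquivalent π πF) ∧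
    -- for `d ≥ 2` there are infinitely many pairwise inequivalent representations `π_α`
    (2 ≤ d → ∃ S : Set (Word d), S.Infinite ∧ ∀ α ∈ S, ∀ α' ∈ S, α ≠ α' →
      ∀ π π', IsWordRep P α π → IsWordRep P α' π' → ¬ UnitarilyEquivalent π π') ∧
    -- if all `q_ij`, `i ≠ j`, vanish, `π_α` is a representation of the Cuntz algebra `O_d` that
    -- permutes an orthonormal basis
    ((∀ i j, i ≠ j → P.q i j = 0) → ∀ (α : Word d) π, IsWordRep P α π →
      Orthonormal ℂ (HSpace.vec P (α := α)) ∧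
      (∀ i j, π (star (W.s i) * W.s j) = if i = j then 1 else 0) ∧
      ∑ j, π (W.s j * star (W.s j)) = 1) := by
  have hequiv : ∀ (α α' : Word d) π π', IsWordRep P α π → IsWordRep P α' π' →
      (UnitarilyEquivalent π π' ↔ TailEquiv α α') := fun α α' π π' hπ hπ' => by
    refine ⟨fun h => ?_, hπ.unitarilyEquivalent hπ'⟩
    -- If `α` and `α'` are inequivalent, the range projections along `α` tend to zero in `π_α'` but
    -- fix `e_α` in `π_α`.
    by_contra hn
    exact hπ.not_unitarilyEquivalent (hπ'.tendsto_rangeProj_zero hn) h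
  refine ⟨fun α β γ => ?_, ?_, fun α => ?_, fun α π hπ => hπ.isIrreducible, hequiv,
    fun α π πF hπ hπF => hπ.not_unitarilyEquivalent (hπF.tendsto_rangeProj_zero α), fun hd => ?_,
    fun hq α π hπ => ⟨HSpace.orthonormal_vec hq α, fun i j => ?_, hπ.sum_s_mul_star_s hq⟩⟩
  · rw [HSpace.inner_vec]
    exact P.tendsto_qWord_take_take γ.1 β.1
  · exact (existsUnique_congr fun _ => isFockRep_iff).mpr
      ((isGramSystem_fock P).existsUnique_rep P.posSemidef_fockGram)
  · exact (existsUnique_congr fun _ => isWordRep_iff).mpr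
      ((isGramSystem_class P α).existsUnique_rep (posSemidef_classGram P α))
  · obtain ⟨S, hS, hne⟩ := exists_infinite_pairwise_not_tailEquiv hd
    exact ⟨S, hS, fun α hα α' hα' h π π' hπ hπ' hu =>
      hne α hα α' hα' h ((hequiv α α' π π' hπ hπ').mp hu)⟩
  · rw [W.star_s_mul_s hq]
    split_ifs
    · exact map_one π
    · exact map_zero π
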